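/- Let $X \subseteq \mathbb{P}^n$ ($n \ge 0$) be an irreducible complex projective subvariety (a nonempty irreducible Zariski-closed subset) that is non-degenerate, i.e. not contained in a hyperplane. For a finite set $\Gamma \subseteq X$ of closed points let $\pi_\Gamma$ be the linear projection of $\mathbb{P}^n$ away from $\operatorname{Span}(\Gamma)$ onto a complementary linear subspace, let $I_{\pi_\Gamma(X)}$ be the saturated homogeneous ideal of the image $\pi_\Gamma(X)$, and set $\kappa_\Gamma(X) := \dim_{\mathbb{C}} (I_{\pi_\Gamma(X)})_2$. The quadratic persistence $\operatorname{qp}(X)$ is the smallest $k \in \mathbb{N}$ for which there is a set $\Gamma \subseteq X$ of $k$ closed points with $(I_{\pi_\Gamma(X)})_2 = 0$. Then: 1. For every $j \in \mathbb{N}$ there is exactly one number $\kappa_j(X) \in \mathbb{N}$ such that $\kappa_{\{p_1,\dots,p_j\}}(X) = \kappa_j(X)$ for a general $j$-tuple $(p_1,\dots,p_j)$ of closed points of $X$ (that is, for all tuples in some Zariski-dense, Zariski-open subset of $X^j$). 2. The sequence $(\kappa_0(X), \kappa_1(X), \kappa_2(X), \dots)$ is weakly decreasing; $\kappa_j(X)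 \neq 0$ if and only if $j < \operatorname{qp}(X)$, so it has exactly $\operatorname{qp}(X)$ nonzero terms; it is strictly decreasing until it reaches zero, i.e. $\kappa_{j+1}(X) < \kappa_j(X)$ for all $0 \le j < \operatorname{qp}(X)$; and it is strictly convex there: $$2\,\kappa_j(X) < \kappa_{j-1}(X) + \kappa_{j+1}(X) \qquad \text{for all } 0 < j \le \operatorname{qp}(X).$$ 3. With $I_X$ the saturated homogeneous ideal of $X$ and $\operatorname{codim}(X) = n - \dim(X)$, $$\binom{\operatorname{qp}(X)+1}{2} \le \dim_{\mathbb{C}} (I_X)_2 \le \operatorname{qp}(X)\,\operatorname{codim}(X) - \binom{\operatorname{qp}(X)}{2}.$$ -/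

import Mathlib

open scoped LinearAlgebra.Projectivization Topology

noncomputable section

namespace QuadPersist

/-- The set of closed points of complex projective space with `m` homogeneous coordinates,
that is, of `ℙ^(m-1)` (empty for `m = 0`). -/
abbrev Pt (m : ℕ) : Type := ℙ ℂ (Fin m → ℂ)

/-! ### The Zariski topology on projective space -/

/-- The closed points at which all the polynomials of `S` vanish; it is used for sets `S` of
homogeneous polynomials, for which the choice of the representatives does not matter. -/
def zeroLocus {m : ℕ} (S : Set (MvPolynomial (Fin m) ℂ)) : Set (Pt m) :=
  {p | ∀ f ∈ S, MvPolynomial.eval p.rep f = 0}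

/-- The subsets of projective space that are cut out by homogeneous polynomials. -/
def algebraicSets (m : ℕ) : Set (Set (Pt m)) :=
  {Z | ∃ S : Set (MvPolynomial (Fin m) ℂ), (∀ f ∈ S, ∃ d : ℕ, f.IsHomogeneous d) ∧
    Z = zeroLocus S}

/-- The Zariski topology on projective space. -/
@[reducible]
def zariski (m : ℕ) : TopologicalSpace (Pt m) :=
  TopologicalSpace.ofClosed (algebraicSets m)
    ⟨{1}, by
      rintro f rfl
      exact ⟨0, MvPolynomial.isHomogeneous_one _ _⟩, by
      ext p; simp [zeroLocus]⟩
    (by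
      intro A hA
      replace hA : ∀ Z ∈ A, ∃ S, _ := fun Z hZ => hA hZ
      choose! S hS hZ using hA
      refine ⟨⋃ Z ∈ A, S Z, ?_, ?_⟩
      · intro f hf
        simp only [Set.mem_iUnion] at hf
        obtain ⟨Z, hZA, hf⟩ := hf
        exact hS Z hZA f hf
      · ext p
        simp only [Set.mem_sInter, zeroLocus, Set.mem_iUnion, Set.mem_ofPred_eq]
        constructor
        · rintro h f ⟨Z, hZA, hf⟩
          have := h Z hZA
          rw [hZ Z hZA] at this
          exact this f hf
        · intro h Z hZA
          rw [hZ Z hZA]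
          exact fun f hf => h f ⟨Z, hZA, hf⟩)
    (by
      rintro _ ⟨S, hS, rfl⟩ _ ⟨T, hT, rfl⟩
      refine ⟨{h | ∃ f ∈ S, ∃ g ∈ T, h = f * g}, ?_, ?_⟩
      · rintro _ ⟨f, hf, g, hg, rfl⟩
        obtain ⟨a, ha⟩ := hS f hf
        obtain ⟨b, hb⟩ := hT g hg
        exact ⟨a + b, ha.mul hb⟩
      · ext p
        constructor
        · rintro (h | h) _ ⟨f, hf, g, hg, rfl⟩
          · simp [h f hf]
          · simp [h g hg]
        · intro h
          by_contra hcon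
          simp only [Set.mem_union, zeroLocus, Set.mem_ofPred_eq, not_or, not_forall] at hcon
          obtain ⟨⟨f, hf, hf0⟩, g, hg, hg0⟩ := hcon
          have := h _ ⟨f, hf, g, hg, rfl⟩
          rw [map_mul] at this
          exact (mul_ne_zero hf0 hg0) this)

/-! ### The Zariski topology on powers of projective space -/

/-- A polynomial in `r` groups of `m` variables that is homogeneous in each of the groups. -/
def IsMultihomogeneous {r m : ℕ} (f : MvPolynomial (Fin r × Fin m) ℂ) : Prop :=
  ∀ i : Fin r, ∃ d : ℕ,
    f.IsWeightedHomogeneous (fun x : Fin r × Fin m => if x.1 = i then 1 else 0) d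

/-- The tuples of closed points at which all the polynomials of `S` vanish; it is used for sets `S`
of multihomogeneous polynomials, for which the choice of the representatives does not matter. -/
def multiZeroLocus {r m : ℕ} (S : Set (MvPolynomial (Fin r × Fin m) ℂ)) : Set (Fin r → Pt m) :=
  {p | ∀ f ∈ S, MvPolynomial.eval (fun x : Fin r × Fin m => (p x.1).rep x.2) f = 0}

/-- The subsets of a power of projective space that are cut out by multihomogeneous polynomials. -/
def multiAlgebraicSets (r m : ℕ) : Set (Set (Fin r → Pt m)) :=
  {Z | ∃ S : Set (MvPolynomial (Fin r × Fin m) ℂ), (∀ f ∈ S, IsMultihomogeneous f) ∧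
    Z = multiZeroLocus S}

/-- The Zariski topology on the `r`-th power of projective space, as a variety (it is finer than
the product of the Zariski topologies). -/
@[reducible]
def zariskiPow (r m : ℕ) : TopologicalSpace (Fin r → Pt m) :=
  TopologicalSpace.ofClosed (multiAlgebraicSets r m)
    ⟨{1}, by
      rintro f rfl i
      exact ⟨0, MvPolynomial.isWeightedHomogeneous_one _ _⟩, by
      ext p; simp [multiZeroLocus]⟩
    (by
      intro A hA
      replace hA : ∀ Z ∈ A, ∃ S, _ := fun Z hZ => hA hZ
      choose! S hS hZ using hA
      refine ⟨⋃ Z ∈ A, S Z, ?_, ?_⟩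
      · intro f hf
        simp only [Set.mem_iUnion] at hf
        obtain ⟨Z, hZA, hf⟩ := hf
        exact hS Z hZA f hf
      · ext p
        simp only [Set.mem_sInter, multiZeroLocus, Set.mem_iUnion, Set.mem_ofPred_eq]
        constructor
        · rintro h f ⟨Z, hZA, hf⟩
          have := h Z hZA
          rw [hZ Z hZA] at this
          exact this f hf
        · intro h Z hZA
          rw [hZ Z hZA]
          exact fun f hf => h f ⟨Z, hZA, hf⟩)
    (by
      rintro _ ⟨S, hS, rfl⟩ _ ⟨T, hT, rfl⟩
      refine ⟨{h | ∃ f ∈ S, ∃ g ∈ T, h = f * g}, ?_, ?_⟩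
      · rintro _ ⟨f, hf, g, hg, rfl⟩ i
        obtain ⟨a, ha⟩ := hS f hf i
        obtain ⟨b, hb⟩ := hT g hg i
        exact ⟨a + b, ha.mul hb⟩
      · ext p
        constructor
        · rintro (h | h) _ ⟨f, hf, g, hg, rfl⟩
          · simp [h f hf]
          · simp [h g hg]
        · intro h
          by_contra hcon
          simp only [Set.mem_union, multiZeroLocus, Set.mem_ofPred_eq, not_or, not_forall] at hcon
          obtain ⟨⟨f, hf, hf0⟩, g, hg, hg0⟩ := hcon
          have := h _ ⟨f, hf, g, hg, rfl⟩
          rw [map_mul] at this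
          exact (mul_ne_zero hf0 hg0) this)

/-! ### Subvarieties

A subvariety (a reduced closed subscheme) is given by its set of closed points. -/

/-- A Zariski closed subset of projective space. -/
def IsSubvariety {m : ℕ} (X : Set (Pt m)) : Prop :=
  IsClosed[zariski m] X

/-- Irreducibility (which includes being nonempty) in the Zariski topology. -/
def IsIrreducibleVariety {m : ℕ} (X : Set (Pt m)) : Prop :=
  @IsIrreducible (Pt m) (zariski m) X

/-- `X` is not contained in a hyperplane. -/
def IsNondegenerate {m : ℕ} (X : Set (Pt m)) : Prop :=
  ∀ H : Submodule ℂ (Fin m → ℂ), IsCoatom H → ∃ p ∈ X, ¬ p.submodule ≤ H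

/-- The dimension of `X`: the Krull dimension of the Zariski topology on `X`. -/
def dimension {m : ℕ} (X : Set (Pt m)) : ℕ :=
  ((@topologicalKrullDim X (TopologicalSpace.induced Subtype.val (zariski m))).unbotD 0).toNat

/-- The codimension of `X ⊆ ℙ^n`. -/
def codimension {n : ℕ} (X : Set (Pt (n + 1))) : ℕ :=
  n - dimension X

/-- The affine cone over `X` without the origin: all homogeneous coordinates of points of `X`. -/
def puncturedCone {m : ℕ} (X : Set (Pt m)) : Set (Fin m → ℂ) :=
  {v | ∃ hv : v ≠ 0, Projectivization.mk ℂ v hv ∈ X}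

/-- The saturated homogeneous ideal `I_X` of a set `X` of closed points: the polynomials that
vanish at all homogeneous coordinates of all points of `X`. -/
def idealOf {m : ℕ} (X : Set (Pt m)) : Ideal (MvPolynomial (Fin m) ℂ) :=
  MvPolynomial.vanishingIdeal ℂ (puncturedCone X)

/-- The vector space `(I_X)_2` of quadrics in the homogeneous ideal of `X`. -/
def quadrics {m : ℕ} (X : Set (Pt m)) : Submodule ℂ (MvPolynomial (Fin m) ℂ) :=
  (idealOf X).restrictScalars ℂ ⊓ MvPolynomial.homogeneousSubmodule (Fin m) ℂ 2

/-! ### Linear projections -/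

/-- The linear subspace of `ℂ^m` whose projectivization is `Span Γ`. -/
def spanOf {m : ℕ} (Γ : Set (Pt m)) : Submodule ℂ (Fin m → ℂ) :=
  ⨆ p ∈ Γ, p.submodule

/-- A (chosen) complement of `spanOf Γ`. -/
def complementOf {m : ℕ} (Γ : Set (Pt m)) : Submodule ℂ (Fin m → ℂ) :=
  (Submodule.exists_isCompl (spanOf Γ)).choose

theorem isCompl_complementOf {m : ℕ} (Γ : Set (Pt m)) : IsCompl (complementOf Γ) (spanOf Γ) :=
  (Submodule.exists_isCompl (spanOf Γ)).choose_spec.symm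

/-- The number of homogeneous coordinates on the target of the projection away from `Γ`. -/
abbrev targetCoords {m : ℕ} (Γ : Set (Pt m)) : ℕ :=
  Module.finrank ℂ (complementOf Γ)

/-- The linear map underlying the projection away from `Γ`: the projection along `spanOf Γ` onto
the complement, followed by linear coordinates on the complement. -/
def projLinear {m : ℕ} (Γ : Set (Pt m)) :
    (Fin m → ℂ) →ₗ[ℂ] (Fin (targetCoords Γ) → ℂ) :=
  (Module.finBasis ℂ (complementOf Γ)).equivFun.toLinearMap ∘ₗ
    (complementOf Γ).projectionOnto (spanOf Γ) (isCompl_complementOf Γ)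

/-- The image `π_Γ(X)` of `X` under the projection away from `Γ`, a rational map that is defined
at the points outside of `Span Γ`, that is, where `projLinear Γ` does not vanish. -/
def projImage {m : ℕ} (Γ X : Set (Pt m)) : Set (Pt (targetCoords Γ)) :=
  {y | ∃ (v : Fin m → ℂ) (hv : v ≠ 0) (h : projLinear Γ v ≠ 0),
    Projectivization.mk ℂ v hv ∈ X ∧ y = Projectivization.mk ℂ (projLinear Γ v) h}

/-- The number `dim (I_{π_Γ(X)})_2` of quadrics kept under the projection away from `Γ`. -/
def kept {m : ℕ} (X Γ : Set (Pt m)) : ℕ :=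
  Module.finrank ℂ (quadrics (projImage Γ X))

/-- The quadratic persistence `qp(X)`: the smallest `k` such that there are `k` closed points in
`X` for which the ideal of the projection of `X` away from them contains no quadrics. -/
def qp {m : ℕ} (X : Set (Pt m)) : ℕ :=
  sInf {k | ∃ Γ : Finset (Pt m), (Γ : Set (Pt m)) ⊆ X ∧ Γ.card = k ∧
    quadrics (projImage (Γ : Set (Pt m)) X) = ⊥}

/-! ### General points -/

/-- The power `X^r`. -/
def power {m : ℕ} (X : Set (Pt m)) (r : ℕ) : Set (Fin r → Pt m) :=
  {p | ∀ i, p i ∈ X}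

/-- `P` holds for a general `r`-tuple of points of `X`: it holds on a dense relatively open subset
of `X^r`. -/
def HoldsGenerally {m : ℕ} (X : Set (Pt m)) (r : ℕ) (P : (Fin r → Pt m) → Prop) : Prop :=
  ∃ U : Set (Fin r → Pt m), IsOpen[zariskiPow r m] U ∧
    power X r ⊆ closure[zariskiPow r m] (U ∩ power X r) ∧ ∀ p ∈ U ∩ power X r, P p

/-- `k` is the number of quadrics kept under the projection away from a general set of `j` points
of `X`. -/
def IsGeneralKept {m : ℕ} (X : Set (Pt m)) (j k : ℕ) : Prop :=
  HoldsGenerally X j (fun p => kept X (Set.range p) = k)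

/-- The number of quadrics kept under the projection away from a general set of `j` points
of `X` (meaningful when exactly one `k` satisfies `IsGeneralKept X j k`). -/
def generalKept {m : ℕ} (X : Set (Pt m)) (j : ℕ) : ℕ :=
  sInf {k | IsGeneralKept X j k}

end QuadPersist

end

noncomputable section

namespace QuadPersist

/-! ### Transcendence degree, differentials and the Jacobian criterion -/

/-! A quadratic form on the target of the projection away from Γ pulls back to a form whose radical
contains `spanOf Γ`, and every such form descends. So κ_Γ(X) is the dimension of the space of
quadrics through X whose polar form is killed by the points of Γ (`map_pullback_quadrics`). These
are linear conditions on (I_X)_2 with coefficients polynomial in the points, so the dimension is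
semicontinuous (`exists_multihomogeneous`). Since X is irreducible, its minimum `minKept` over
j-tuples is the general value.

Write B_q for the polar form of q. If q ≠ 0 contains the nondegenerate X, then B_q(x, y) ≠ 0 for
some x, y in X (`exists_polarForm_ne_zero`). Adding x to a tuple excludes q, which gives strict
decrease. For convexity, take j + 2 general points, the last two being a and b. Let V be the
quadrics singular at the first j points, and V_a, V_b those also singular at a, respectively b. Then
V_a ∩ V_b has dimension κ_{j+2}, and V_a, V_b have dimension at least κ_{j+1}. The sum V_a + V_b is
proper in V, because B_q(a, b) = 0 on it while this fails for some q in V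
(`minKept_strictly_convex`).

The bounds on κ_0 come from summing the drops κ_j - κ_{j+1}. Strict convexity makes them increase by
at least one per step backwards from qp(X), and decrease by at least one per step forwards from κ_0
- κ_1. That first drop is the rank of the gradients of the quadrics at one point of X, which is at
most the codimension by the Jacobian criterion (`add_dimension_le`). Dimension is reached through
transcendence degrees of coordinate rings of cones, which bound the length of chains of irreducible
closed sets. -/

/-- Lift a transcendence basis of B to A and adjoin a. If a were algebraic over the lifts, a nonzero
polynomial in them would be a multiple of a, and applying φ would give a relation in B. -/
theorem trdeg_add_one_le_of_surjective {k A B : Type} [Field k] [CommRing A]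
    [IsDomain A] [CommRing B] [IsDomain B] [Algebra k A] [Algebra k B]
    (φ : A →ₐ[k] B) (hφ : Function.Surjective φ) {a : A} (ha : a ≠ 0) (ha0 : φ a = 0) :
    Algebra.trdeg k B + 1 ≤ Algebra.trdeg k A := by
  obtain ⟨s, hs⟩ := exists_isTranscendenceBasis k B
  have hy := hs.1
  choose x hx using fun i : s => hφ i
  have hxy : AlgebraicIndependent k (φ ∘ x) := by
    convert hy using 1
    ext i; simp [hx]
  have hxi : AlgebraicIndependent k x := hxy.of_comp φ
  have hind : AlgebraicIndependent k (fun o : Option s => o.elim a x) := by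
    refine (hxi.option_iff_transcendental a).2 fun halg => ?_
    obtain ⟨⟨r, hr⟩, hr0, c, hc⟩ := halg.exists_nonzero_dvd (mem_nonZeroDivisors_of_ne_zero ha)
    rw [Algebra.adjoin_range_eq_range_aeval] at hr
    obtain ⟨g, rfl⟩ := hr
    apply hr0
    have h0 : φ (MvPolynomial.aeval x g) = 0 := by
      have : MvPolynomial.aeval x g = a * c := hc
      rw [this, map_mul, ha0, zero_mul]
    have : g = 0 := hxy.eq_zero_of_aeval_eq_zero _ <| by
      rw [← h0]
      exact (MvPolynomial.comp_aeval_apply x φ g).symm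
    ext
    simp [this]
  have := hind.cardinalMk_le_trdeg
  rwa [Cardinal.mk_option, hs.cardinalMk_eq_trdeg] at this

open scoped IntermediateField.algebraAdjoinAdjoin in
-- In characteristic zero K is formally étale over the polynomial ring on a transcendence basis, so
-- its differentials are the base change of a free module on that basis.
theorem rank_kaehlerDifferential_eq_trdeg (k K : Type) [Field k] [Field K] [Algebra k K]
    [CharZero k] : Module.rank K (Ω[K⁄k]) = Algebra.trdeg k K := by
  obtain ⟨s, hs⟩ := exists_isTranscendenceBasis k K
  let v : s → K := Subtype.val
  let A := Algebra.adjoin k (Set.range v)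
  let L := IntermediateField.adjoin k (Set.range v)
  have : Algebra.IsAlgebraic L K := hs.isAlgebraic_field
  have : CharZero L := charZero_of_injective_algebraMap (algebraMap k L).injective
  have : Algebra.FormallyEtale L K := Algebra.FormallyEtale.of_isSeparable _ K
  have : Algebra.FormallyEtale A L := Algebra.FormallyEtale.of_isLocalization (nonZeroDivisors A)
  have : Algebra.FormallyEtale A K := .comp _ L _
  let e : MvPolynomial s k ≃ₐ[k] A := hs.1.aevalEquiv
  let _ : Algebra (MvPolynomial s k) A := e.toRingEquiv.toRingHom.toAlgebra
  let _ : Algebra (MvPolynomial s k) K := ((algebraMap A K).comp (algebraMap _ A)).toAlgebra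
  have : IsScalarTower (MvPolynomial s k) A K := .of_algebraMap_eq fun _ => rfl
  have : IsScalarTower k (MvPolynomial s k) A := .of_algebraMap_eq fun x => (e.commutes x).symm
  have : IsScalarTower k (MvPolynomial s k) K := .of_algebraMap_eq fun x => by
    change _ = algebraMap A K (e (algebraMap k _ x))
    rw [e.commutes]; rfl
  have : Algebra.FormallyEtale (MvPolynomial s k) A := by
    let e' : MvPolynomial s k ≃ₐ[MvPolynomial s k] A :=
      { e.toRingEquiv with commutes' := fun _ => rfl }
    exact .of_equiv e'
  have : Algebra.FormallyEtale (MvPolynomial s k) K := .comp _ A _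
  have h := KaehlerDifferential.isBaseChange_of_formallyEtale k (MvPolynomial s k) K
  rw [(h.basis (KaehlerDifferential.mvPolynomialBasis k s)).mk_eq_rank''.symm,
    hs.cardinalMk_eq_trdeg]

theorem trdeg_fractionRing {k A K : Type} [Field k] [CommRing A] [IsDomain A] [Algebra k A]
    [Field K] [Algebra A K] [IsFractionRing A K] [Algebra k K] [IsScalarTower k A K] :
    Algebra.trdeg k K = Algebra.trdeg k A := by
  have : Algebra.IsAlgebraic A K := IsLocalization.isAlgebraic K (nonZeroDivisors A)
  rw [← trdeg_add_eq k A (A := K), trdeg_eq_zero (R := A), add_zero]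

open KaehlerDifferential in
-- The differentials of the coordinates span Ω of the fraction field K of the quotient. Each element
-- of P gives a linear relation among them, and the nonzero minor makes these a relations
-- independent over K.
theorem trdeg_add_le_of_jacobian {k σ : Type} [Field k] [CharZero k] [Fintype σ]
    (P : Ideal (MvPolynomial σ k)) [P.IsPrime] {a : ℕ} (q : Fin a → MvPolynomial σ k)
    (hq : ∀ i, q i ∈ P) (c : Fin a → σ)
    (hdet : Matrix.det (Matrix.of fun i j : Fin a => MvPolynomial.pderiv (c j) (q i)) ∉ P) :
    Algebra.trdeg k (MvPolynomial σ k ⧸ P) + a ≤ Fintype.card σ := by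
  let A := MvPolynomial σ k ⧸ P
  let K := FractionRing A
  let f : MvPolynomial σ k →+* K := algebraMap _ K
  have hf0 : ∀ x, f x = 0 ↔ x ∈ P := by
    intro x
    change algebraMap A K (Ideal.Quotient.mk P x) = 0 ↔ _
    rw [FaithfulSMul.algebraMap_eq_zero_iff, Ideal.Quotient.eq_zero_iff_mem]
  have hD : ∀ x : MvPolynomial σ k,
      D k K (f x) = ∑ s, f (MvPolynomial.pderiv s x) • D k K (f (MvPolynomial.X s)) := by
    intro x
    let D₁ : Derivation k (MvPolynomial σ k) (Ω[K⁄k]) := (D k K).compAlgebraMap (MvPolynomial σ k)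
    let D₂ : Derivation k (MvPolynomial σ k) (Ω[K⁄k]) :=
      ∑ s, (LinearMap.toSpanSingleton (MvPolynomial σ k) (Ω[K⁄k])
        (D k K (f (MvPolynomial.X s)))).compDer (MvPolynomial.pderiv s)
    have happ : ∀ x, D₂ x = ∑ s, f (MvPolynomial.pderiv s x) • D k K (f (MvPolynomial.X s)) := by
      intro x
      change Derivation.coeFnAddMonoidHom D₂ x = _
      rw [map_sum, Finset.sum_apply]
      refine Finset.sum_congr rfl fun s _ => ?_
      rw [Derivation.coeFnAddMonoidHom_apply, Derivation.coe_comp]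
      simp [f, algebraMap_smul]
    have h12 : D₁ = D₂ := by
      classical
      refine MvPolynomial.derivation_ext fun i => ?_
      rw [happ, Finset.sum_eq_single i]
      · rw [MvPolynomial.pderiv_X_self, map_one, one_smul]
        rfl
      · intro j _ hji
        rw [MvPolynomial.pderiv_X_of_ne hji.symm, map_zero, zero_smul]
      · simp
    rw [← happ, ← h12]
    rfl
  let Φ : (σ → K) →ₗ[K] Ω[K⁄k] :=
    Fintype.linearCombination K fun s => D k K (f (MvPolynomial.X s))
  have hΦ : ∀ c, Φ c = ∑ s, c s • D k K (f (MvPolynomial.X s)) :=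
    fun c => Fintype.linearCombination_apply _ _ _
  have hsurj : Function.Surjective Φ := by
    rw [← LinearMap.range_eq_top, eq_top_iff, ← span_range_derivation, Submodule.span_le]
    rintro _ ⟨y, rfl⟩
    have hmem : ∀ x, D k K (f x) ∈ LinearMap.range Φ := fun x => by
      rw [hD x, ← hΦ fun s => f (MvPolynomial.pderiv s x)]
      exact LinearMap.mem_range_self _ _
    obtain ⟨n, d, hd, rfl⟩ := IsFractionRing.div_surjective (A := A) y
    obtain ⟨n, rfl⟩ := Ideal.Quotient.mk_surjective n
    obtain ⟨d, rfl⟩ := Ideal.Quotient.mk_surjective d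
    rw [SetLike.mem_coe, Derivation.leibniz_div]
    exact Submodule.smul_mem _ _ (Submodule.sub_mem _ (Submodule.smul_mem _ _ (hmem n))
      (Submodule.smul_mem _ _ (hmem d)))
  let g : Fin a → σ → K := fun i s => f (MvPolynomial.pderiv s (q i))
  have hg : ∀ i, g i ∈ LinearMap.ker Φ := fun i => by
    rw [LinearMap.mem_ker, hΦ, ← hD, (hf0 _).2 (hq i), map_zero]
  have hli : LinearIndependent K g := by
    refine LinearIndependent.of_comp (LinearMap.funLeft K K c) ?_
    have : LinearMap.funLeft K K c ∘ g =
        (f.mapMatrix (Matrix.of fun i j : Fin a => MvPolynomial.pderiv (c j) (q i))).row := rfl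
    rw [this, Matrix.linearIndependent_rows_iff_isUnit, Matrix.isUnit_iff_isUnit_det,
      ← RingHom.map_det, isUnit_iff_ne_zero]
    exact fun h => hdet ((hf0 _).1 h)
  have hker : a ≤ Module.finrank K (LinearMap.ker Φ) := by
    have hli' : LinearIndependent K (fun i => (⟨g i, hg i⟩ : LinearMap.ker Φ)) :=
      LinearIndependent.of_comp (LinearMap.ker Φ).subtype hli
    simpa using hli'.fintype_card_le_finrank
  have hrn := LinearMap.finrank_range_add_finrank_ker Φ
  have : Module.Finite K (Ω[K⁄k]) := Module.Finite.of_surjective Φ hsurj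
  rw [LinearMap.range_eq_top.2 hsurj, finrank_top, Module.finrank_pi] at hrn
  rw [← trdeg_fractionRing (A := A) (K := K), ← rank_kaehlerDifferential_eq_trdeg,
    ← Module.finrank_eq_rank]
  exact_mod_cast (by omega : Module.finrank K (Ω[K⁄k]) + a ≤ Fintype.card σ)

/-! ### The symmetric bilinear form of a quadratic polynomial -/

/-- The matrix of second partial derivatives at the origin. -/
def hessian (m : ℕ) : MvPolynomial (Fin m) ℂ →ₗ[ℂ] Matrix (Fin m) (Fin m) ℂ :=
  LinearMap.pi fun a => LinearMap.pi fun b =>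
    (MvPolynomial.aeval (0 : Fin m → ℂ)).toLinearMap ∘ₗ
      (MvPolynomial.pderiv a).toLinearMap ∘ₗ (MvPolynomial.pderiv b).toLinearMap

/-- The bilinear form given by the second partial derivatives at the origin. For a quadratic form
`q` it is the polarization of `q`. -/
def polarForm (m : ℕ) :
    MvPolynomial (Fin m) ℂ →ₗ[ℂ] (Fin m → ℂ) →ₗ[ℂ] (Fin m → ℂ) →ₗ[ℂ] ℂ :=
  (Matrix.toBilin' (R₁ := ℂ) (n := Fin m)).toLinearMap ∘ₗ hessian m

variable {m : ℕ}

theorem hessian_apply (q : MvPolynomial (Fin m) ℂ) (a b : Fin m) :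
    hessian m q a b = MvPolynomial.eval 0 (MvPolynomial.pderiv a (MvPolynomial.pderiv b q)) := by
  rw [← MvPolynomial.coe_aeval_eq_eval]
  rfl

theorem polarForm_apply (q : MvPolynomial (Fin m) ℂ) (v w : Fin m → ℂ) :
    polarForm m q v w = ∑ a, ∑ b, v a * hessian m q a b * w b := by
  simp [polarForm, Matrix.toBilin'_apply]

theorem pderiv_pderiv_comm {R σ : Type*} [CommRing R] (i j : σ) (q : MvPolynomial σ R) :
    MvPolynomial.pderiv i (MvPolynomial.pderiv j q) =
      MvPolynomial.pderiv j (MvPolynomial.pderiv i q) := by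
  classical
  have h : ⁅MvPolynomial.pderiv (R := R) i, MvPolynomial.pderiv (R := R) j⁆ = 0 := by
    refine MvPolynomial.derivation_ext fun k => ?_
    rw [Derivation.commutator_apply, MvPolynomial.pderiv_X, MvPolynomial.pderiv_X]
    simp [Pi.single_apply, apply_ite]
  rw [← sub_eq_zero, ← Derivation.commutator_apply, h, Derivation.zero_apply]

theorem polarForm_comm (q : MvPolynomial (Fin m) ℂ) (v w : Fin m → ℂ) :
    polarForm m q v w = polarForm m q w v := by
  rw [polarForm_apply, polarForm_apply, Finset.sum_comm]
  refine Finset.sum_congr rfl fun a _ => Finset.sum_congr rfl fun b _ => ?_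
  rw [hessian_apply, hessian_apply, pderiv_pderiv_comm a b]
  ring

theorem eval_eq_sum_of_isHomogeneous_one {f : MvPolynomial (Fin m) ℂ} (hf : f.IsHomogeneous 1)
    (v : Fin m → ℂ) :
    MvPolynomial.eval v f = ∑ a, v a * MvPolynomial.eval 0 (MvPolynomial.pderiv a f) := by
  have h := congrArg (MvPolynomial.eval v) hf.sum_X_mul_pderiv
  rw [one_smul, map_sum] at h
  rw [← h]
  refine Finset.sum_congr rfl fun a _ => ?_
  have h0 : (MvPolynomial.pderiv a f).IsHomogeneous 0 := hf.pderiv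
  rw [← MvPolynomial.totalDegree_zero_iff_isHomogeneous,
    MvPolynomial.totalDegree_eq_zero_iff_eq_C] at h0
  rw [h0]
  simp

theorem sum_mul_eval_pderiv {q : MvPolynomial (Fin m) ℂ} (hq : q.IsHomogeneous 2)
    (v w : Fin m → ℂ) :
    ∑ b, w b * MvPolynomial.eval v (MvPolynomial.pderiv b q) = polarForm m q v w := by
  rw [polarForm_apply, Finset.sum_comm]
  refine Finset.sum_congr rfl fun b _ => ?_
  rw [eval_eq_sum_of_isHomogeneous_one (hq.pderiv : (MvPolynomial.pderiv b q).IsHomogeneous 1),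
    Finset.mul_sum]
  refine Finset.sum_congr rfl fun a _ => ?_
  rw [hessian_apply]
  ring

theorem polarForm_self {q : MvPolynomial (Fin m) ℂ} (hq : q.IsHomogeneous 2) (v : Fin m → ℂ) :
    polarForm m q v v = 2 * MvPolynomial.eval v q := by
  have h := congrArg (MvPolynomial.eval v) hq.sum_X_mul_pderiv
  rw [← sum_mul_eval_pderiv hq]
  simpa using h

theorem eq_zero_of_polarForm_eq_zero {q : MvPolynomial (Fin m) ℂ} (hq : q.IsHomogeneous 2)
    (h : polarForm m q = 0) : q = 0 := by
  refine MvPolynomial.funext fun v => ?_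
  have := polarForm_self hq v
  simpa [h] using this.symm

theorem eval_add_of_isHomogeneous_two {q : MvPolynomial (Fin m) ℂ} (hq : q.IsHomogeneous 2)
    (v w : Fin m → ℂ) : MvPolynomial.eval (v + w) q =
      MvPolynomial.eval v q + polarForm m q v w + MvPolynomial.eval w q := by
  have h := polarForm_self hq (v + w)
  rw [map_add, map_add, LinearMap.add_apply, LinearMap.add_apply, polarForm_self hq, polarForm_self hq,
    polarForm_comm q w v] at h
  linear_combination -h / 2

theorem eval_smul_of_isHomogeneous {d : ℕ} {f : MvPolynomial (Fin m) ℂ} (hf : f.IsHomogeneous d)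
    (t : ℂ) (v : Fin m → ℂ) :
    MvPolynomial.eval (t • v) f = t ^ d * MvPolynomial.eval v f := by
  simp only [MvPolynomial.eval_eq, Finset.mul_sum]
  refine Finset.sum_congr rfl fun s hs => ?_
  simp only [Pi.smul_apply, smul_eq_mul, mul_pow, Finset.prod_mul_distrib]
  rw [Finset.prod_pow_eq_pow_sum, hf.degree_eq_sum_deg_support hs]
  ring

/-! ### Cones and their ideals -/

theorem mem_idealOf {X : Set (Pt m)} {f : MvPolynomial (Fin m) ℂ} :
    f ∈ idealOf X ↔ ∀ p ∈ X, ∀ t : ℂ, t ≠ 0 → MvPolynomial.eval (t • p.rep) f = 0 := by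
  rw [idealOf, MvPolynomial.mem_vanishingIdeal_iff]
  constructor
  · intro h p hp t ht
    have := h (t • p.rep) ⟨smul_ne_zero ht p.rep_nonzero, ?_⟩
    · simpa [MvPolynomial.aeval_eq_eval] using this
    · convert hp
      conv_rhs => rw [← p.mk_rep]
      rw [Projectivization.mk_eq_mk_iff']
      exact ⟨t, rfl⟩
  · rintro h v ⟨hv, hvX⟩
    obtain ⟨t, ht⟩ := Projectivization.exists_smul_eq_mk_rep ℂ v hv
    have := h _ hvX (↑t⁻¹) (Units.ne_zero _)
    rw [← ht] at this
    simpa [MvPolynomial.aeval_eq_eval, Units.smul_def] using this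

theorem mem_idealOf_of_isHomogeneous {X : Set (Pt m)} {f : MvPolynomial (Fin m) ℂ} {d : ℕ}
    (hf : f.IsHomogeneous d) : f ∈ idealOf X ↔ ∀ p ∈ X, MvPolynomial.eval p.rep f = 0 := by
  rw [mem_idealOf]
  constructor
  · intro h p hp
    simpa using h p hp 1 one_ne_zero
  · intro h p hp t _
    rw [eval_smul_of_isHomogeneous hf, h p hp, mul_zero]

theorem isOpen_ne_zero {f : MvPolynomial (Fin m) ℂ} {d : ℕ} (hf : f.IsHomogeneous d) :
    IsOpen[zariski m] {p : Pt m | MvPolynomial.eval p.rep f ≠ 0} := by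
  refine ⟨{f}, ?_, ?_⟩
  · rintro _ rfl
    exact ⟨d, hf⟩
  · ext p
    simp [zeroLocus]

theorem IsSubvariety.exists_eq_zeroLocus {X : Set (Pt m)} (hX : IsSubvariety X) :
    ∃ S : Set (MvPolynomial (Fin m) ℂ), (∀ f ∈ S, ∃ d : ℕ, f.IsHomogeneous d) ∧
      X = zeroLocus S := by
  obtain ⟨S, hS, h⟩ : Xᶜᶜ ∈ algebraicSets m := (@isOpen_compl_iff _ X (zariski m)).2 hX
  exact ⟨S, hS, by rw [← h, compl_compl]⟩

/-- Nonvanishing loci of homogeneous polynomials on the points of `X` meet when nonempty. -/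
theorem exists_ne_zero_of_irreducible {X : Set (Pt m)} (hX : IsIrreducibleVariety X)
    {f g : MvPolynomial (Fin m) ℂ} {d e : ℕ} (hf : f.IsHomogeneous d) (hg : g.IsHomogeneous e)
    (hfX : ∃ p ∈ X, MvPolynomial.eval p.rep f ≠ 0) (hgX : ∃ p ∈ X, MvPolynomial.eval p.rep g ≠ 0) :
    ∃ p ∈ X, MvPolynomial.eval p.rep f ≠ 0 ∧ MvPolynomial.eval p.rep g ≠ 0 :=
  @hX.2 _ _ (isOpen_ne_zero hf) (isOpen_ne_zero hg) hfX hgX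

theorem exists_homogeneousComponent_ne_zero {f : MvPolynomial (Fin m) ℂ} {v : Fin m → ℂ}
    (h : MvPolynomial.eval v f ≠ 0) :
    ∃ d, MvPolynomial.eval v (MvPolynomial.homogeneousComponent d f) ≠ 0 := by
  by_contra! hcon
  apply h
  rw [← MvPolynomial.sum_homogeneousComponent f, map_sum]
  exact Finset.sum_eq_zero fun d _ => hcon d

/-- The restriction of a polynomial to the line through `v`, as a polynomial in one variable. -/
def lineRestrict (v : Fin m → ℂ) : MvPolynomial (Fin m) ℂ →ₐ[ℂ] Polynomial ℂ :=
  MvPolynomial.aeval fun i => Polynomial.C (v i) * Polynomial.X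

theorem eval_lineRestrict (v : Fin m → ℂ) (f : MvPolynomial (Fin m) ℂ) (t : ℂ) :
    (lineRestrict v f).eval t = MvPolynomial.eval (t • v) f := by
  rw [lineRestrict, ← Polynomial.coe_evalRingHom, MvPolynomial.map_aeval, MvPolynomial.eval,
    MvPolynomial.coe_eval₂Hom, MvPolynomial.coe_eval₂Hom]
  congr 1
  · ext x
    simp
  · ext i
    rw [Polynomial.coe_evalRingHom, Polynomial.eval_mul, Polynomial.eval_C, Polynomial.eval_X,
      Pi.smul_apply, smul_eq_mul, mul_comm]

theorem eval_homogeneousComponent_eq_coeff (v : Fin m → ℂ) (f : MvPolynomial (Fin m) ℂ) (d : ℕ) :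
    MvPolynomial.eval v (MvPolynomial.homogeneousComponent d f) = (lineRestrict v f).coeff d := by
  have h : lineRestrict v f = ∑ i ∈ Finset.range (f.totalDegree + 1),
      Polynomial.monomial i (MvPolynomial.eval v (MvPolynomial.homogeneousComponent i f)) := by
    refine Polynomial.funext fun t => ?_
    rw [eval_lineRestrict, Polynomial.eval_finsetSum]
    conv_lhs => rw [← MvPolynomial.sum_homogeneousComponent f, map_sum]
    refine Finset.sum_congr rfl fun i _ => ?_
    rw [eval_smul_of_isHomogeneous (MvPolynomial.homogeneousComponent_isHomogeneous i f),
      Polynomial.eval_monomial, mul_comm]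
  rw [h, Polynomial.finsetSum_coeff]
  simp only [Polynomial.coeff_monomial, Finset.sum_ite_eq', Finset.mem_range]
  split_ifs with hd
  · rfl
  · rw [MvPolynomial.homogeneousComponent_eq_zero _ _ (by omega), map_zero]

theorem exists_smul_ne_zero_of_lineRestrict_ne_zero {v : Fin m → ℂ} {f : MvPolynomial (Fin m) ℂ}
    (h : lineRestrict v f ≠ 0) : ∃ t : ℂ, t ≠ 0 ∧ MvPolynomial.eval (t • v) f ≠ 0 := by
  by_contra! hcon
  -- The value at t = 0 is not controlled; the factor X removes it.
  refine mul_ne_zero h Polynomial.X_ne_zero (Polynomial.funext fun t => ?_)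
  by_cases ht : t = 0
  · simp [ht]
  · simp [eval_lineRestrict, hcon t ht]

/-- If f and g are not in the ideal, suitable homogeneous components are nonzero at a common point
of X. On the line through it both restrict to nonzero polynomials in one variable, hence so does the
product. -/
theorem isPrime_idealOf {X : Set (Pt m)} (hX : IsIrreducibleVariety X) : (idealOf X).IsPrime := by
  refine ⟨?_, ?_⟩
  · obtain ⟨p, hp⟩ := hX.1
    rw [Ne, Ideal.eq_top_iff_one, mem_idealOf]
    intro h
    simpa using h p hp 1 one_ne_zero
  · intro f g hfg
    by_contra! hcon
    simp only [mem_idealOf, not_forall] at hcon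
    obtain ⟨⟨p, hp, s, hs, hf⟩, ⟨r, hr, t, ht, hg⟩⟩ := hcon
    obtain ⟨d, hd⟩ := exists_homogeneousComponent_ne_zero hf
    obtain ⟨e, he⟩ := exists_homogeneousComponent_ne_zero hg
    have hfd := MvPolynomial.homogeneousComponent_isHomogeneous d f
    have hge := MvPolynomial.homogeneousComponent_isHomogeneous e g
    rw [eval_smul_of_isHomogeneous hfd] at hd
    rw [eval_smul_of_isHomogeneous hge] at he
    obtain ⟨u, hu, hfu, hgu⟩ := exists_ne_zero_of_irreducible hX hfd hge
      ⟨p, hp, right_ne_zero_of_mul hd⟩ ⟨r, hr, right_ne_zero_of_mul he⟩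
    rw [eval_homogeneousComponent_eq_coeff] at hfu hgu
    have hne : lineRestrict u.rep (f * g) ≠ 0 := by
      rw [map_mul]
      exact mul_ne_zero (fun h => hfu (by simp [h])) (fun h => hgu (by simp [h]))
    obtain ⟨c, hc, hne⟩ := exists_smul_ne_zero_of_lineRestrict_ne_zero hne
    exact hne (mem_idealOf.1 hfg u hu c hc)

/-! ### Dimension -/

theorem exists_det_ne_zero {K I : Type} [Field K] [Finite I] {r : ℕ} (M : Fin r → I → K)
    (h : LinearIndependent K M) :
    ∃ c : Fin r → I, (Matrix.of fun i j => M i (c j)).det ≠ 0 := by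
  have := Fintype.ofFinite I
  have hr : Module.finrank K (Submodule.span K (Set.range (Matrix.of M).col)) = r := by
    rw [← Matrix.rank_eq_finrank_span_cols]
    simpa using LinearIndependent.rank_matrix (M := Matrix.of M) h
  obtain ⟨f, hf, -, hli⟩ := Submodule.exists_fun_fin_finrank_span_eq K (Set.range (Matrix.of M).col)
  choose c hc using hf
  refine ⟨fun j => c (finCongr hr.symm j), ?_⟩
  have : (Matrix.of fun i j => M i (c (finCongr hr.symm j))).col = f ∘ finCongr hr.symm := by
    ext j i
    simp [← hc]
  have hli' : LinearIndependent K (Matrix.of fun i j => M i (c (finCongr hr.symm j))).col := by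
    rw [this]
    exact hli.comp _ (finCongr hr.symm).injective
  rw [Matrix.linearIndependent_cols_iff_isUnit, Matrix.isUnit_iff_isUnit_det] at hli'
  exact hli'.ne_zero

/-- The dimension of the affine cone over `X`, when `X` is irreducible. -/
def coneDim (X : Set (Pt m)) : ℕ :=
  (Algebra.trdeg ℂ (MvPolynomial (Fin m) ℂ ⧸ idealOf X)).toNat

theorem coe_coneDim {X : Set (Pt m)} (hX : IsIrreducibleVariety X) :
    (coneDim X : Cardinal) = Algebra.trdeg ℂ (MvPolynomial (Fin m) ℂ ⧸ idealOf X) := by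
  have := isPrime_idealOf hX
  exact Cardinal.cast_toNat_of_lt_aleph0 trdeg_lt_aleph0_of_finiteType

/-- A form that vanishes on Y but not on Z is a nonzero element of the kernel of the surjection
between the coordinate rings. -/
theorem coneDim_lt {Y Z : Set (Pt m)} (hY : IsIrreducibleVariety Y) (hZ : IsIrreducibleVariety Z)
    (hYc : IsSubvariety Y) (h : Y ⊂ Z) : coneDim Y < coneDim Z := by
  have := isPrime_idealOf hY
  have := isPrime_idealOf hZ
  have hle : idealOf Z ≤ idealOf Y := fun f hf => mem_idealOf.2 fun p hp =>
    mem_idealOf.1 hf p (h.1 hp)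
  obtain ⟨p, hpZ, hpY⟩ := Set.exists_of_ssubset h
  obtain ⟨S, hS, hYS⟩ := hYc.exists_eq_zeroLocus
  obtain ⟨f, hfS, hf⟩ : ∃ f ∈ S, MvPolynomial.eval p.rep f ≠ 0 := by
    by_contra! hcon
    exact hpY (hYS ▸ hcon)
  obtain ⟨d, hd⟩ := hS f hfS
  have hfY : f ∈ idealOf Y := (mem_idealOf_of_isHomogeneous hd).2 fun y hy => by
    rw [hYS] at hy
    exact hy f hfS
  have hfZ : f ∉ idealOf Z := fun h => hf ((mem_idealOf_of_isHomogeneous hd).1 h p hpZ)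
  have := trdeg_add_one_le_of_surjective (Ideal.Quotient.factorₐ ℂ hle)
    (Ideal.Quotient.factor_surjective hle) (a := Ideal.Quotient.mk _ f)
    (by rwa [Ne, Ideal.Quotient.eq_zero_iff_mem])
    (by
      change Ideal.Quotient.mk _ f = 0
      rwa [Ideal.Quotient.eq_zero_iff_mem])
  rw [← coe_coneDim hY, ← coe_coneDim hZ] at this
  exact_mod_cast this

theorem coneDim_mono {Y Z : Set (Pt m)} (hY : IsIrreducibleVariety Y) (hZ : IsIrreducibleVariety Z)
    (hYc : IsSubvariety Y) (h : Y ⊆ Z) : coneDim Y ≤ coneDim Z := by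
  rcases h.eq_or_ssubset with rfl | h
  · rfl
  · exact (coneDim_lt hY hZ hYc h).le

/-- A coordinate that is nonzero at some point of X takes every nonzero value on the corresponding
line, so it is transcendental in the coordinate ring. -/
theorem coneDim_pos {X : Set (Pt m)} (hX : IsIrreducibleVariety X) : 0 < coneDim X := by
  have := isPrime_idealOf hX
  obtain ⟨p, hp⟩ := hX.1
  obtain ⟨i, hi⟩ := Function.ne_iff.1 p.rep_nonzero
  have : Algebra.Transcendental ℂ (MvPolynomial (Fin m) ℂ ⧸ idealOf X) := by
    refine ⟨⟨Ideal.Quotient.mk _ (MvPolynomial.X i), fun ⟨g, hg0, hg⟩ => hg0 ?_⟩⟩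
    have hmem : Polynomial.aeval (MvPolynomial.X i) g ∈ idealOf X := by
      rw [← Ideal.Quotient.eq_zero_iff_mem, ← hg, ← Ideal.Quotient.mkₐ_eq_mk ℂ,
        Polynomial.aeval_algHom_apply]
    have h0 : g * Polynomial.X = 0 := by
      refine Polynomial.funext fun t => ?_
      by_cases ht : t = 0
      · simp [ht]
      have := mem_idealOf.1 hmem p hp (t / p.rep i) (div_ne_zero ht hi)
      rw [← MvPolynomial.coe_aeval_eq_eval] at this
      change MvPolynomial.aeval ((t / p.rep i) • p.rep) (Polynomial.aeval _ g) = 0 at this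
      rw [← Polynomial.aeval_algHom_apply, MvPolynomial.aeval_X, Pi.smul_apply, smul_eq_mul,
        div_mul_cancel₀ _ hi, Polynomial.coe_aeval_eq_eval] at this
      simp [this]
    exact (mul_eq_zero.1 h0).resolve_right Polynomial.X_ne_zero
  have := trdeg_pos ℂ (MvPolynomial (Fin m) ℂ ⧸ idealOf X)
  rw [← coe_coneDim hX] at this
  exact_mod_cast this

theorem isHomogeneous_of_mem_quadrics {X : Set (Pt m)} {q : MvPolynomial (Fin m) ℂ}
    (hq : q ∈ quadrics X) : q.IsHomogeneous 2 := hq.2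

theorem mem_idealOf_of_mem_quadrics {X : Set (Pt m)} {q : MvPolynomial (Fin m) ℂ}
    (hq : q ∈ quadrics X) : q ∈ idealOf X := hq.1

/-- The functional B_q(p, ·) is the gradient of q at p, so independence gives a Jacobian minor that
is nonzero at p and hence not in the ideal. The point p may be singular on X. -/
theorem coneDim_add_le {X : Set (Pt m)} (hX : IsIrreducibleVariety X) {p : Pt m} (hp : p ∈ X)
    {a : ℕ} (q : Fin a → MvPolynomial (Fin m) ℂ) (hq : ∀ i, q i ∈ quadrics X)
    (hli : LinearIndependent ℂ fun i => polarForm m (q i) p.rep) : coneDim X + a ≤ m := by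
  have := isPrime_idealOf hX
  have hM : LinearIndependent ℂ fun i s => MvPolynomial.eval p.rep (MvPolynomial.pderiv s (q i)) := by
    refine LinearIndependent.of_comp
      (Fintype.linearCombination ℂ fun s : Fin m => (LinearMap.proj s : (Fin m → ℂ) →ₗ[ℂ] ℂ)) ?_
    convert hli using 1
    ext1 i
    refine LinearMap.ext fun w => ?_
    rw [← sum_mul_eval_pderiv (isHomogeneous_of_mem_quadrics (hq i)), Function.comp_apply,
      Fintype.linearCombination_apply, LinearMap.sum_apply]
    exact Finset.sum_congr rfl fun s _ => mul_comm _ _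
  obtain ⟨c, hc⟩ := exists_det_ne_zero _ hM
  have := trdeg_add_le_of_jacobian (idealOf X) q (fun i => mem_idealOf_of_mem_quadrics (hq i)) c
    (fun hmem => hc ?_)
  · rw [← coe_coneDim hX, Fintype.card_fin] at this
    exact_mod_cast this
  · have := mem_idealOf.1 hmem p hp 1 one_ne_zero
    rw [one_smul, RingHom.map_det] at this
    exact this

theorem add_dimension_le {n : ℕ} {X : Set (Pt (n + 1))} (hXc : IsSubvariety X)
    (hX : IsIrreducibleVariety X) {p : Pt (n + 1)} (hp : p ∈ X)
    {a : ℕ} (q : Fin a → MvPolynomial (Fin (n + 1)) ℂ) (hq : ∀ i, q i ∈ quadrics X)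
    (hli : LinearIndependent ℂ fun i => polarForm (n + 1) (q i) p.rep) : a + dimension X ≤ n := by
  have hle := coneDim_add_le hX hp q hq hli
  let _ := zariski (n + 1)
  let _ : TopologicalSpace X := .induced Subtype.val (zariski (n + 1))
  have hI : ∀ Z : TopologicalSpace.IrreducibleCloseds X,
      IsIrreducibleVariety (Subtype.val '' Z.carrier) ∧
        IsSubvariety (Subtype.val '' Z.carrier) := fun Z =>
    ⟨Z.isIrreducible'.image _ continuous_subtype_val.continuousOn,
      (Topology.IsClosedEmbedding.mk .subtypeVal
        (by rwa [Subtype.range_coe])).isClosedMap _ Z.isClosed'⟩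
  have hpos := fun Z => coneDim_pos (hI Z).1
  have hmax := fun Z : TopologicalSpace.IrreducibleCloseds X =>
    coneDim_mono (hI Z).1 hX (hI Z).2 (Subtype.coe_image_subset X Z.carrier)
  -- The cone has one dimension more than the variety, hence the shift by 1. Chains embed strictly
  -- into a set of n + 1 - a elements.
  have hmono : StrictMono fun Z : TopologicalSpace.IrreducibleCloseds X =>
      (⟨coneDim (Subtype.val '' Z.carrier) - 1, by have := hpos Z; have := hmax Z; omega⟩ :
        Fin (n + 1 - a)) := by
    intro Y Z hYZ
    have : coneDim (Subtype.val '' Y.carrier) < coneDim (Subtype.val '' Z.carrier) :=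
      coneDim_lt (hI Y).1 (hI Z).1 (hI Y).2
        (Subtype.val_injective.image_strictMono hYZ)
    have := hpos Y
    rw [Fin.lt_def]
    dsimp only
    omega
  have hdim : topologicalKrullDim X < (n + 1 - a : ℕ) :=
    Order.krullDim_lt_coe_iff.2 fun l => by simpa using (l.map _ hmono).length_lt_card
  have hle' : dimension X < n + 1 - a := by
    change ((topologicalKrullDim X).unbotD 0).toNat < _
    -- `dimension` sends `⊥` to 0, so that case needs a ≤ n, which follows from positivity of
    -- `coneDim X`.
    have hXpos := coneDim_pos hX
    revert hdim
    generalize topologicalKrullDim X = d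
    intro hd
    induction d with
    | bot => simp; omega
    | coe d =>
      obtain ⟨k, rfl⟩ := ENat.ne_top_iff_exists.1 (ne_top_of_lt (WithBot.coe_lt_coe.1 hd))
      simpa using ENat.natCast_lt_natCast.1 (WithBot.coe_lt_coe.1 hd)
  omega

/-! ### Quadrics on linear projections -/

variable {m' : ℕ}

/-- The substitution of a linear map into polynomials. -/
def pullback (L : (Fin m → ℂ) →ₗ[ℂ] (Fin m' → ℂ)) :
    MvPolynomial (Fin m') ℂ →ₐ[ℂ] MvPolynomial (Fin m) ℂ :=
  MvPolynomial.aeval fun i => ∑ j, MvPolynomial.C (L (Pi.single j 1) i) * MvPolynomial.X j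

theorem eval_pullback (L : (Fin m → ℂ) →ₗ[ℂ] (Fin m' → ℂ)) (f : MvPolynomial (Fin m') ℂ)
    (v : Fin m → ℂ) : MvPolynomial.eval v (pullback L f) = MvPolynomial.eval (L v) f := by
  rw [pullback, ← MvPolynomial.coe_aeval_eq_eval, ← MvPolynomial.coe_aeval_eq_eval]
  change MvPolynomial.aeval v _ = MvPolynomial.aeval (L v) f
  rw [MvPolynomial.comp_aeval_apply]
  congr 2
  ext i
  conv_rhs => rw [LinearMap.pi_apply_eq_sum_univ L v]
  have : ∀ j : Fin m, (fun k => if j = k then (1 : ℂ) else 0) = Pi.single j 1 := fun j => by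
    ext k; simp [Pi.single_apply, eq_comm]
  simp [mul_comm, this]

theorem isHomogeneous_pullback (L : (Fin m → ℂ) →ₗ[ℂ] (Fin m' → ℂ)) {f : MvPolynomial (Fin m') ℂ}
    {d : ℕ} (hf : f.IsHomogeneous d) : (pullback L f).IsHomogeneous d := by
  have := hf.aeval (n := 1) (fun i => ∑ j, MvPolynomial.C (L (Pi.single j 1) i) * MvPolynomial.X j)
    fun i => MvPolynomial.IsHomogeneous.sum _ _ _ fun j _ => MvPolynomial.isHomogeneous_C_mul_X _ _
  rwa [one_mul] at this

/-- The quadrics containing `X` whose polar form has all vectors of `S` in its radical. -/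
def singularQuadrics (X : Set (Pt m)) (S : Set (Fin m → ℂ)) :
    Submodule ℂ (MvPolynomial (Fin m) ℂ) where
  carrier := {q | q ∈ quadrics X ∧ ∀ v ∈ S, polarForm m q v = 0}
  zero_mem' := ⟨zero_mem _, fun v _ => by simp⟩
  add_mem' := fun ha hb => ⟨add_mem ha.1 hb.1, fun v hv => by simp [ha.2 v hv, hb.2 v hv]⟩
  smul_mem' := fun c _ ha => ⟨Submodule.smul_mem _ c ha.1, fun v hv => by simp [ha.2 v hv]⟩

theorem mem_singularQuadrics {X : Set (Pt m)} {S : Set (Fin m → ℂ)}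
    {q : MvPolynomial (Fin m) ℂ} :
    q ∈ singularQuadrics X S ↔ q ∈ quadrics X ∧ ∀ v ∈ S, polarForm m q v = 0 := Iff.rfl

theorem mem_quadrics {X : Set (Pt m)} {q : MvPolynomial (Fin m) ℂ} :
    q ∈ quadrics X ↔ q.IsHomogeneous 2 ∧ ∀ p ∈ X, MvPolynomial.eval p.rep q = 0 :=
  ⟨fun h => ⟨h.2, (mem_idealOf_of_isHomogeneous h.2).1 h.1⟩,
    fun h => ⟨(mem_idealOf_of_isHomogeneous h.1).2 h.2, h.1⟩⟩

theorem eval_eq_zero_of_mem_quadrics {X : Set (Pt m)} {q : MvPolynomial (Fin m) ℂ}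
    (hq : q ∈ quadrics X) {v : Fin m → ℂ} (hv : v ≠ 0) (hvX : Projectivization.mk ℂ v hv ∈ X) :
    MvPolynomial.eval v q = 0 := by
  have := (MvPolynomial.mem_vanishingIdeal_iff.1 hq.1) v ⟨hv, hvX⟩
  rwa [← MvPolynomial.coe_aeval_eq_eval]

theorem projLinear_eq_zero {Γ : Set (Pt m)} {v : Fin m → ℂ} (hv : v ∈ spanOf Γ) :
    projLinear Γ v = 0 := by
  rw [projLinear, LinearMap.comp_apply,
    Submodule.projectionOnto_apply_eq_zero_iff _ |>.2 hv, map_zero]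

/-- The inclusion of the complement, a section of the projection away from `Γ`. -/
def projSection (Γ : Set (Pt m)) : (Fin (targetCoords Γ) → ℂ) →ₗ[ℂ] (Fin m → ℂ) :=
  (complementOf Γ).subtype ∘ₗ (Module.finBasis ℂ (complementOf Γ)).equivFun.symm.toLinearMap

theorem projLinear_projSection (Γ : Set (Pt m)) (y : Fin (targetCoords Γ) → ℂ) :
    projLinear Γ (projSection Γ y) = y := by
  simp only [projLinear, projSection, LinearMap.comp_apply, LinearEquiv.coe_coe,
    Submodule.subtype_apply, Submodule.projectionOnto_apply_left, LinearEquiv.apply_symm_apply]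

theorem sub_projSection_mem (Γ : Set (Pt m)) (v : Fin m → ℂ) :
    v - projSection Γ (projLinear Γ v) ∈ spanOf Γ := by
  rw [← Submodule.projectionOnto_apply_eq_zero_iff (isCompl_complementOf Γ), map_sub]
  simp only [projLinear, projSection, LinearMap.comp_apply, LinearEquiv.coe_coe,
    Submodule.subtype_apply, Submodule.projectionOnto_apply_left, LinearEquiv.symm_apply_apply,
    sub_self]

theorem polarForm_eq_zero_of_mem_spanOf {X Γ : Set (Pt m)} {q : MvPolynomial (Fin m) ℂ}
    (hq : q ∈ singularQuadrics X (Projectivization.rep '' Γ)) {v : Fin m → ℂ}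
    (hv : v ∈ spanOf Γ) : polarForm m q v = 0 := by
  have hle : spanOf Γ ≤ LinearMap.ker (polarForm m q) := by
    refine iSup₂_le fun p hp => ?_
    rw [Projectivization.submodule_eq, Submodule.span_singleton_le_iff_mem]
    exact hq.2 _ ⟨p, hp, rfl⟩
  exact hle hv

/-- A pulled-back form is invariant under translation by `spanOf Γ`, which puts Γ in its radical.
Conversely a form with Γ in its radical depends only on the projected vector, so restricting it to
the complement descends it. -/
theorem map_pullback_quadrics (X Γ : Set (Pt m)) :
    (quadrics (projImage Γ X)).map (pullback (projLinear Γ)).toLinearMap =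
      singularQuadrics X (Projectivization.rep '' Γ) := by
  refine le_antisymm ?_ ?_
  · rintro _ ⟨f, hf, rfl⟩
    have hf2 := isHomogeneous_of_mem_quadrics hf
    have hg2 := isHomogeneous_pullback (projLinear Γ) hf2
    have h0 : MvPolynomial.eval 0 f = 0 := by
      simpa using eval_smul_of_isHomogeneous hf2 0 0
    refine ⟨mem_quadrics.2 ⟨hg2, fun p hp => ?_⟩, ?_⟩
    · change MvPolynomial.eval p.rep (pullback _ f) = 0
      rw [eval_pullback]
      by_cases h : projLinear Γ p.rep = 0
      · rw [h, h0]
      · exact eval_eq_zero_of_mem_quadrics hf h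
          ⟨p.rep, p.rep_nonzero, h, by rwa [p.mk_rep], rfl⟩
    · rintro _ ⟨p, hp, rfl⟩
      refine LinearMap.ext fun w => ?_
      have hpΓ : p.rep ∈ spanOf Γ := by
        refine Submodule.mem_iSup_of_mem p (Submodule.mem_iSup_of_mem hp ?_)
        rw [Projectivization.submodule_eq]
        exact Submodule.mem_span_singleton_self _
      have := eval_add_of_isHomogeneous_two hg2 p.rep w
      rw [eval_pullback, eval_pullback, eval_pullback, map_add, projLinear_eq_zero hpΓ, zero_add,
        h0, zero_add, right_eq_add] at this
      exact this
  · intro g hg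
    have hg2 := isHomogeneous_of_mem_quadrics hg.1
    have key : ∀ v, MvPolynomial.eval (projSection Γ (projLinear Γ v)) g =
        MvPolynomial.eval v g := by
      intro v
      have hw := polarForm_eq_zero_of_mem_spanOf hg (sub_projSection_mem Γ v)
      have h1 := eval_add_of_isHomogeneous_two hg2 (v - projSection Γ (projLinear Γ v))
        (projSection Γ (projLinear Γ v))
      have h2 := polarForm_self hg2 (v - projSection Γ (projLinear Γ v))
      rw [hw, LinearMap.zero_apply] at h1 h2
      rw [sub_add_cancel] at h1
      linear_combination -h1 + h2 / 2
    refine ⟨pullback (projSection Γ) g, ⟨?_, isHomogeneous_pullback _ hg2⟩, ?_⟩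
    · refine MvPolynomial.mem_vanishingIdeal_iff.2 ?_
      rintro x ⟨hx, v, hv, hπ, hvX, hxv⟩
      obtain ⟨t, rfl⟩ := (Projectivization.mk_eq_mk_iff' ℂ _ _ _ _).1 hxv
      change MvPolynomial.eval (t • projLinear Γ v) _ = 0
      rw [eval_smul_of_isHomogeneous (isHomogeneous_pullback _ hg2), eval_pullback, key,
        eval_eq_zero_of_mem_quadrics hg.1 hv hvX, mul_zero]
    · refine MvPolynomial.funext fun v => ?_
      change MvPolynomial.eval v (pullback _ (pullback _ g)) = _
      rw [eval_pullback, eval_pullback, key]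

theorem pullback_projLinear_injective (Γ : Set (Pt m)) :
    Function.Injective (pullback (projLinear Γ)).toLinearMap := by
  intro f g h
  refine MvPolynomial.funext fun y => ?_
  have := congrArg (MvPolynomial.eval (projSection Γ y)) h
  change MvPolynomial.eval _ (pullback _ f) = MvPolynomial.eval _ (pullback _ g) at this
  rwa [eval_pullback, eval_pullback, projLinear_projSection] at this

theorem kept_eq_finrank (X Γ : Set (Pt m)) :
    kept X Γ = Module.finrank ℂ (singularQuadrics X (Projectivization.rep '' Γ)) := by
  rw [← map_pullback_quadrics]
  exact (Submodule.equivMapOfInjective _ (pullback_projLinear_injective Γ) _).finrank_eq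

theorem quadrics_projImage_eq_bot_iff (X Γ : Set (Pt m)) :
    quadrics (projImage Γ X) = ⊥ ↔ singularQuadrics X (Projectivization.rep '' Γ) = ⊥ := by
  rw [← map_pullback_quadrics, ← Submodule.map_bot (pullback (projLinear Γ)).toLinearMap,
    (Submodule.map_injective_of_injective (pullback_projLinear_injective Γ)).eq_iff]

instance finite_quadrics (X : Set (Pt m)) : Module.Finite ℂ (quadrics X) := by
  have : Module.Finite ℂ (MvPolynomial.homogeneousSubmodule (Fin m) ℂ 2) :=
    Module.Finite.iff_fg.2 (MvPolynomial.homogeneousSubmodule_fg _ _ _)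
  exact Module.Finite.of_injective _
    (Submodule.inclusion_injective (inf_le_right : quadrics X ≤ _))

/-! ### Tuples of points and semicontinuity -/

/-- A function of finitely many points that is given by a homogeneous polynomial in each of them
when the others are fixed. -/
def IsSliceHomogeneous {ι : Type} [DecidableEq ι] (F : (ι → Pt m) → ℂ) : Prop :=
  ∀ (i : ι) (p : ι → Pt m), ∃ (d : ℕ) (f : MvPolynomial (Fin m) ℂ), f.IsHomogeneous d ∧
    ∀ x : Pt m, F (Function.update p i x) = MvPolynomial.eval x.rep f

theorem IsSliceHomogeneous.comp {ι κ : Type} [DecidableEq ι] [DecidableEq κ] {F : (κ → Pt m) → ℂ}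
    (hF : IsSliceHomogeneous F) {e : κ → ι} (he : Function.Injective e) :
    IsSliceHomogeneous fun p : ι → Pt m => F (p ∘ e) := by
  intro i p
  by_cases hi : ∃ k, e k = i
  · obtain ⟨k, rfl⟩ := hi
    obtain ⟨d, f, hf, h⟩ := hF k (p ∘ e)
    exact ⟨d, f, hf, fun x => by
      beta_reduce
      rw [← h, Function.update_comp_eq_of_injective _ he]⟩
  · refine ⟨0, MvPolynomial.C (F (p ∘ e)), MvPolynomial.isHomogeneous_C _ _, fun x => ?_⟩
    beta_reduce
    rw [Function.update_comp_eq_of_forall_ne _ _ fun k hk => hi ⟨k, hk⟩, MvPolynomial.eval_C]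

/-- This plays the role of irreducibility of the power of X. The two tuples are merged one
coordinate at a time, each moved to a common point of X where neither slice vanishes. Coordinates
that already agree stay fixed, which the convexity argument needs. -/
theorem exists_common_ne_zero {X : Set (Pt m)} (hX : IsIrreducibleVariety X)
    {ι : Type} [Fintype ι] [DecidableEq ι] {F G : (ι → Pt m) → ℂ}
    (hF : IsSliceHomogeneous F) (hG : IsSliceHomogeneous G) {p q : ι → Pt m}
    (hp : ∀ i, p i ∈ X) (hq : ∀ i, q i ∈ X) (hFp : F p ≠ 0) (hGq : G q ≠ 0) :
    ∃ r : ι → Pt m, (∀ i, r i ∈ X) ∧ F r ≠ 0 ∧ G r ≠ 0 ∧ ∀ i, p i = q i → r i = p i := by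
  suffices h : ∀ S : Finset ι, ∃ p' q' : ι → Pt m, (∀ i, p' i ∈ X) ∧ (∀ i, q' i ∈ X) ∧
      F p' ≠ 0 ∧ G q' ≠ 0 ∧ (∀ i ∈ S, p' i = q' i) ∧
      ∀ i, p i = q i → p' i = p i ∧ q' i = p i by
    obtain ⟨p', q', hp', -, hF', hG', heq, hpq⟩ := h Finset.univ
    obtain rfl : p' = q' := funext fun i => heq i (Finset.mem_univ i)
    exact ⟨p', hp', hF', hG', fun i hi => (hpq i hi).1⟩
  intro S
  induction S using Finset.induction_on with
  | empty => exact ⟨p, q, hp, hq, hFp, hGq, by simp, fun i hi => ⟨rfl, hi.symm⟩⟩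
  | insert a S _ ih =>
    obtain ⟨p', q', hp', hq', hF', hG', heq, hpq⟩ := ih
    by_cases ha : p a = q a
    · refine ⟨p', q', hp', hq', hF', hG', fun i hi => ?_, hpq⟩
      rcases Finset.mem_insert.1 hi with rfl | hi
      · rw [(hpq _ ha).1, (hpq _ ha).2]
      · exact heq i hi
    obtain ⟨d, f, hf, hfF⟩ := hF a p'
    obtain ⟨e, g, hg, hgG⟩ := hG a q'
    obtain ⟨x, hxX, hfx, hgx⟩ := exists_ne_zero_of_irreducible hX hf hg
      ⟨p' a, hp' a, by rwa [← hfF, Function.update_eq_self]⟩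
      ⟨q' a, hq' a, by rwa [← hgG, Function.update_eq_self]⟩
    refine ⟨Function.update p' a x, Function.update q' a x, ?_, ?_, by rwa [hfF], by rwa [hgG],
      ?_, ?_⟩
    · intro i
      by_cases hi : i = a
      · subst hi; simpa
      · simpa [hi] using hp' i
    · intro i
      by_cases hi : i = a
      · subst hi; simpa
      · simpa [hi] using hq' i
    · intro i hi
      by_cases hia : i = a
      · subst hia; simp
      · simpa [hia] using heq i ((Finset.mem_insert.1 hi).resolve_left hia)
    · intro i hi
      have hia : i ≠ a := by rintro rfl; exact ha hi
      simpa [hia] using hpq i hi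

theorem isHomogeneous_aeval_of_isWeightedHomogeneous {σ τ : Type*} {w : σ → ℕ}
    {f : MvPolynomial σ ℂ} {d : ℕ} (hf : f.IsWeightedHomogeneous w d)
    {g : σ → MvPolynomial τ ℂ} (hg : ∀ x, (g x).IsHomogeneous (w x)) :
    (MvPolynomial.aeval g f).IsHomogeneous d := by
  rw [MvPolynomial.aeval_def, MvPolynomial.eval₂_eq]
  refine MvPolynomial.IsHomogeneous.sum _ _ _ fun s hs => ?_
  refine MvPolynomial.IsHomogeneous.C_mul ?_ _
  have := MvPolynomial.IsHomogeneous.prod s.support (fun x => g x ^ s x) (fun x => w x * s x)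
    fun x _ => (hg x).pow _
  convert this using 1
  rw [← hf (MvPolynomial.mem_support_iff.1 hs), Finsupp.weight_apply, Finsupp.sum]
  exact Finset.sum_congr rfl fun x _ => by rw [smul_eq_mul, mul_comm]

/-- The value of a polynomial at the chosen representatives of a tuple of points. -/
def evalTuple {r : ℕ} (f : MvPolynomial (Fin r × Fin m) ℂ) (p : Fin r → Pt m) : ℂ :=
  MvPolynomial.eval (fun x : Fin r × Fin m => (p x.1).rep x.2) f

theorem IsMultihomogeneous.isSliceHomogeneous {r : ℕ} {f : MvPolynomial (Fin r × Fin m) ℂ}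
    (hf : IsMultihomogeneous f) : IsSliceHomogeneous (evalTuple f) := by
  intro i p
  obtain ⟨d, hd⟩ := hf i
  refine ⟨d, MvPolynomial.aeval (fun x : Fin r × Fin m =>
    if x.1 = i then MvPolynomial.X x.2 else MvPolynomial.C ((p x.1).rep x.2)) f,
    isHomogeneous_aeval_of_isWeightedHomogeneous hd fun x => ?_, fun x => ?_⟩
  · split_ifs
    · exact MvPolynomial.isHomogeneous_X _ _
    · exact MvPolynomial.isHomogeneous_C _ _
  · rw [evalTuple, ← MvPolynomial.coe_aeval_eq_eval, ← MvPolynomial.coe_aeval_eq_eval]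
    change MvPolynomial.aeval _ f = MvPolynomial.aeval x.rep _
    rw [MvPolynomial.comp_aeval_apply]
    congr 2
    ext y
    by_cases hy : y.1 = i
    · simp [hy]
    · simp [hy]

/-- The quadrics containing `X` that are singular at all the points of a tuple. -/
def tupleQuadrics (X : Set (Pt m)) {ι : Type} (p : ι → Pt m) :
    Submodule ℂ (MvPolynomial (Fin m) ℂ) :=
  singularQuadrics X (Set.range fun i => (p i).rep)

theorem mem_tupleQuadrics {X : Set (Pt m)} {ι : Type} {p : ι → Pt m}
    {q : MvPolynomial (Fin m) ℂ} :
    q ∈ tupleQuadrics X p ↔ q ∈ quadrics X ∧ ∀ i, polarForm m q (p i).rep = 0 := by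
  rw [tupleQuadrics, mem_singularQuadrics, Set.forall_mem_range]

theorem kept_range (X : Set (Pt m)) {r : ℕ} (p : Fin r → Pt m) :
    kept X (Set.range p) = Module.finrank ℂ (tupleQuadrics X p) := by
  rw [kept_eq_finrank, tupleQuadrics, ← Set.range_comp]
  rfl

theorem tupleQuadrics_le_quadrics (X : Set (Pt m)) {ι : Type} (p : ι → Pt m) :
    tupleQuadrics X p ≤ quadrics X := fun _ h => h.1

instance finite_tupleQuadrics (X : Set (Pt m)) {ι : Type} (p : ι → Pt m) :
    Module.Finite ℂ (tupleQuadrics X p) :=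
  Module.Finite.of_injective _ (Submodule.inclusion_injective (tupleQuadrics_le_quadrics X p))

/-- The gradients of the quadrics at the points of a tuple. -/
def gradients (X : Set (Pt m)) {r : ℕ} (p : Fin r → Pt m) :
    quadrics X →ₗ[ℂ] (Fin r × Fin m → ℂ) :=
  LinearMap.pi fun x =>
    LinearMap.applyₗ (Pi.single x.2 1) ∘ₗ LinearMap.applyₗ (p x.1).rep ∘ₗ
      polarForm m ∘ₗ (quadrics X).subtype

theorem gradients_apply (X : Set (Pt m)) {r : ℕ} (p : Fin r → Pt m) (q : quadrics X)
    (x : Fin r × Fin m) :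
    gradients X p q x = polarForm m q (p x.1).rep (Pi.single x.2 1) := rfl

theorem finrank_range_gradients_add (X : Set (Pt m)) {r : ℕ} (p : Fin r → Pt m) :
    Module.finrank ℂ (LinearMap.range (gradients X p)) + Module.finrank ℂ (tupleQuadrics X p) =
      Module.finrank ℂ (quadrics X) := by
  have hker : (LinearMap.ker (gradients X p)).map (quadrics X).subtype = tupleQuadrics X p := by
    ext q
    rw [mem_tupleQuadrics, Submodule.mem_map]
    constructor
    · rintro ⟨q, hq, rfl⟩
      refine ⟨q.2, fun i => LinearMap.pi_ext' fun a => LinearMap.ext_ring ?_⟩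
      exact congrFun hq (i, a)
    · rintro ⟨hqX, hq⟩
      refine ⟨⟨q, hqX⟩, ?_, rfl⟩
      ext x
      rw [gradients_apply, hq x.1]
      rfl
  rw [← hker, ← (Submodule.equivMapOfInjective _ (Submodule.subtype_injective _) _).finrank_eq]
  exact LinearMap.finrank_range_add_finrank_ker _

theorem gradients_eq_sum (X : Set (Pt m)) {r : ℕ} (p : Fin r → Pt m) (q : quadrics X)
    (x : Fin r × Fin m) :
    gradients X p q x = ∑ b, hessian m q b x.2 * (p x.1).rep b := by
  rw [gradients_apply, polarForm_apply]
  refine Finset.sum_congr rfl fun b _ => ?_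
  rw [Finset.sum_eq_single x.2]
  · simp [mul_comm]
  · intro c _ hc
    simp [hc]
  · simp

theorem exists_linearIndependent_gradients (X : Set (Pt m)) {r : ℕ} (p : Fin r → Pt m) :
    ∃ q : Fin (Module.finrank ℂ (LinearMap.range (gradients X p))) → quadrics X,
      LinearIndependent ℂ fun u => gradients X p (q u) := by
  let b := Module.finBasis ℂ (LinearMap.range (gradients X p))
  choose q hq using fun u => (b u).2
  have hli := b.linearIndependent.map' _
    (LinearMap.ker_eq_bot.2 (Submodule.subtype_injective (LinearMap.range (gradients X p))))
  have heq : (fun u => gradients X p (q u)) =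
      (LinearMap.range (gradients X p)).subtype ∘ b := funext hq
  exact ⟨q, by rwa [heq]⟩

/-- Semicontinuity: near a given tuple the space of singular quadrics does not grow. -/
theorem exists_multihomogeneous (X : Set (Pt m)) {r : ℕ} (p₀ : Fin r → Pt m) :
    ∃ f : MvPolynomial (Fin r × Fin m) ℂ, IsMultihomogeneous f ∧ evalTuple f p₀ ≠ 0 ∧
      ∀ p, evalTuple f p ≠ 0 → Module.finrank ℂ (tupleQuadrics X p) ≤
        Module.finrank ℂ (tupleQuadrics X p₀) := by
  obtain ⟨q, hli⟩ := exists_linearIndependent_gradients X p₀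
  obtain ⟨c, hc⟩ := exists_det_ne_zero _ hli
  -- A maximal minor of the gradient matrix that is nonzero at p₀, with the points turned into
  -- variables.
  let M : Matrix (Fin (Module.finrank ℂ (LinearMap.range (gradients X p₀))))
      (Fin (Module.finrank ℂ (LinearMap.range (gradients X p₀)))) (MvPolynomial (Fin r × Fin m) ℂ) :=
    Matrix.of fun u t => ∑ b, MvPolynomial.C (hessian m (q u) b (c t).2) *
      MvPolynomial.X ((c t).1, b)
  have hM : ∀ p, evalTuple M.det p = (Matrix.of fun u t => gradients X p (q u) (c t)).det := by
    intro p
    rw [evalTuple, RingHom.map_det]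
    congr 1
    ext u t
    simp [M, gradients_eq_sum]
  -- The multidegree of an entry depends only on its column, so all terms of the determinant have
  -- the same multidegree.
  have hMdeg : ∀ i u t, (M u t).IsWeightedHomogeneous
      (fun x : Fin r × Fin m => if x.1 = i then 1 else 0) (if (c t).1 = i then 1 else 0) := by
    intro i u t
    refine MvPolynomial.IsWeightedHomogeneous.sum Finset.univ
      (fun b => MvPolynomial.C (hessian m (q u) b (c t).2) * MvPolynomial.X ((c t).1, b)) _
      fun b _ => ?_
    rw [← MvPolynomial.smul_eq_C_mul]
    exact (MvPolynomial.weightedHomogeneousSubmodule ℂ _ _).smul_mem _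
      (MvPolynomial.isWeightedHomogeneous_X ℂ
        (fun x : Fin r × Fin m => if x.1 = i then 1 else 0) ((c t).1, b))
  refine ⟨M.det, ?_, by rwa [hM], fun p hp => ?_⟩
  · intro i
    refine ⟨∑ t, if (c t).1 = i then 1 else 0, ?_⟩
    rw [Matrix.det_apply]
    refine (MvPolynomial.weightedHomogeneousSubmodule ℂ _ _).sum_mem fun σ _ => ?_
    rw [Units.smul_def, ← Int.cast_smul_eq_zsmul ℂ]
    refine Submodule.smul_mem _ _ ?_
    refine MvPolynomial.IsWeightedHomogeneous.prod _ _ _ fun t _ => ?_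
    exact hMdeg i (σ t) t
  · rw [hM, ← isUnit_iff_ne_zero, ← Matrix.isUnit_iff_isUnit_det,
      ← Matrix.linearIndependent_rows_iff_isUnit] at hp
    have hli : LinearIndependent ℂ fun u => gradients X p (q u) :=
      LinearIndependent.of_comp (LinearMap.funLeft ℂ ℂ c) hp
    have hli' : LinearIndependent ℂ fun u => (gradients X p).rangeRestrict (q u) :=
      LinearIndependent.of_comp (LinearMap.range (gradients X p)).subtype hli
    have h1 := hli'.fintype_card_le_finrank
    rw [Fintype.card_fin] at h1
    have h2 := finrank_range_gradients_add X p
    have h3 := finrank_range_gradients_add X p₀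
    omega

/-! ### General tuples -/

/-- The least dimension of the space of quadrics containing `X` that are singular at `j` points
of `X`. -/
def minKept (X : Set (Pt m)) (j : ℕ) : ℕ :=
  sInf ((fun p : Fin j → Pt m => Module.finrank ℂ (tupleQuadrics X p)) '' power X j)

theorem minKept_le {X : Set (Pt m)} {j : ℕ} {p : Fin j → Pt m} (hp : p ∈ power X j) :
    minKept X j ≤ Module.finrank ℂ (tupleQuadrics X p) :=
  Nat.sInf_le ⟨p, hp, rfl⟩

theorem exists_minKept_eq {X : Set (Pt m)} (hX : X.Nonempty) (j : ℕ) :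
    ∃ p ∈ power X j, Module.finrank ℂ (tupleQuadrics X p) = minKept X j := by
  obtain ⟨x, hx⟩ := hX
  have hne : (power X j).Nonempty := ⟨fun _ => x, fun _ => hx⟩
  exact Nat.sInf_mem (hne.image _)

theorem isOpen_evalTuple_ne_zero {r : ℕ} {f : MvPolynomial (Fin r × Fin m) ℂ}
    (hf : IsMultihomogeneous f) : IsOpen[zariskiPow r m] {p : Fin r → Pt m | evalTuple f p ≠ 0} := by
  refine ⟨{f}, ?_, ?_⟩
  · rintro _ rfl
    exact hf
  · ext p
    simp [multiZeroLocus, evalTuple]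

/-- The open set is the nonvanishing locus of the minor attached to a minimizing tuple; it is dense
because any two nonvanishing loci that meet the power of X meet there in common. -/
theorem isGeneralKept_minKept {X : Set (Pt m)} (hX : IsIrreducibleVariety X) (j : ℕ) :
    IsGeneralKept X j (minKept X j) := by
  obtain ⟨p₀, hp₀, hmin⟩ := exists_minKept_eq hX.1 j
  obtain ⟨f, hf, hf0, hle⟩ := exists_multihomogeneous X p₀
  refine ⟨_, isOpen_evalTuple_ne_zero hf, ?_, ?_⟩
  · intro p hp
    let _ := zariskiPow j m
    rw [mem_closure_iff]
    intro O hO hpO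
    obtain ⟨S, hS, hOS⟩ : Oᶜ ∈ multiAlgebraicSets j m := hO
    obtain ⟨g, hgS, hg⟩ : ∃ g ∈ S, evalTuple g p ≠ 0 := by
      by_contra! hcon
      have : p ∈ Oᶜ := by rw [hOS]; exact hcon
      exact this hpO
    obtain ⟨q, hqX, hqf, hqg, -⟩ := exists_common_ne_zero hX hf.isSliceHomogeneous
      (hS g hgS).isSliceHomogeneous hp₀ hp hf0 hg
    refine ⟨q, ?_, hqf, hqX⟩
    by_contra hqO
    have : q ∈ Oᶜ := hqO
    rw [hOS] at this
    exact hqg (this g hgS)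
  · rintro p ⟨hpf, hpX⟩
    rw [kept_range]
    exact le_antisymm ((hle p hpf).trans_eq hmin) (minKept_le hpX)

theorem isGeneralKept_iff {X : Set (Pt m)} (hX : IsIrreducibleVariety X) (j k : ℕ) :
    IsGeneralKept X j k ↔ k = minKept X j := by
  refine ⟨fun h => ?_, fun h => h ▸ isGeneralKept_minKept hX j⟩
  obtain ⟨U, hU, hUX, hUk⟩ := h
  obtain ⟨W, hW, hWX, hWk⟩ := isGeneralKept_minKept hX j
  obtain ⟨x, hx⟩ := hX.1
  let _ := zariskiPow j m
  have hpow : (fun _ => x : Fin j → Pt m) ∈ power X j := fun _ => hx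
  obtain ⟨p, -, hpU⟩ := mem_closure_iff.1 (hUX hpow) Set.univ isOpen_univ trivial
  obtain ⟨q, hqU, hqW⟩ := mem_closure_iff.1 (hWX hpU.2) U hU hpU.1
  rw [← hUk q ⟨hqU, hqW.2⟩, hWk q hqW]

theorem generalKept_eq_minKept {X : Set (Pt m)} (hX : IsIrreducibleVariety X) (j : ℕ) :
    generalKept X j = minKept X j := by
  have : {k | IsGeneralKept X j k} = {minKept X j} := Set.ext fun k => isGeneralKept_iff hX j k
  rw [generalKept, this, csInf_singleton]

/-! ### Nondegeneracy -/

theorem exists_not_mem_of_isNondegenerate {X : Set (Pt m)} (hX : IsNondegenerate X)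
    {W : Submodule ℂ (Fin m → ℂ)} (hW : W ≠ ⊤) : ∃ p ∈ X, p.rep ∉ W := by
  obtain ⟨H, hH, hle⟩ := (eq_top_or_exists_le_coatom W).resolve_left hW
  obtain ⟨p, hp, hpH⟩ := hX H hH
  refine ⟨p, hp, fun h => hpH ?_⟩
  rw [Projectivization.submodule_eq, Submodule.span_singleton_le_iff_mem]
  exact hle h

/-- Nondegeneracy is used twice: first the radical of the form is a proper subspace, then so is the
kernel of the functional given by x. -/
theorem exists_polarForm_ne_zero {X : Set (Pt m)} (hX : IsNondegenerate X)
    {q : MvPolynomial (Fin m) ℂ} (hq : q ∈ quadrics X) (hq0 : q ≠ 0) :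
    ∃ x ∈ X, ∃ y ∈ X, polarForm m q x.rep y.rep ≠ 0 := by
  have h1 : LinearMap.ker (polarForm m q) ≠ ⊤ := fun h =>
    hq0 (eq_zero_of_polarForm_eq_zero (isHomogeneous_of_mem_quadrics hq) (LinearMap.ker_eq_top.1 h))
  obtain ⟨x, hx, hxq⟩ := exists_not_mem_of_isNondegenerate hX h1
  have h2 : LinearMap.ker (polarForm m q x.rep) ≠ ⊤ := fun h =>
    hxq (LinearMap.ker_eq_top.1 h)
  obtain ⟨y, hy, hyq⟩ := exists_not_mem_of_isNondegenerate hX h2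
  exact ⟨x, hx, y, hy, hyq⟩

/-! ### Monotonicity and convexity -/

theorem tupleQuadrics_anti {X : Set (Pt m)} {ι κ : Type} {p : ι → Pt m} {q : κ → Pt m}
    (h : Set.range p ⊆ Set.range q) : tupleQuadrics X q ≤ tupleQuadrics X p := by
  intro f hf
  rw [mem_tupleQuadrics] at hf ⊢
  refine ⟨hf.1, fun i => ?_⟩
  obtain ⟨k, hk⟩ := h ⟨i, rfl⟩
  rw [← hk]
  exact hf.2 k

theorem antitone_minKept {X : Set (Pt m)} (hX : X.Nonempty) : Antitone (minKept X) := by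
  refine antitone_nat_of_succ_le fun j => ?_
  obtain ⟨p, hp, hmin⟩ := exists_minKept_eq hX j
  obtain ⟨x, hx⟩ := hX
  have hmem : Fin.snoc p x ∈ power X (j + 1) := fun i => by
    induction i using Fin.lastCases with
    | last => simpa using hx
    | cast i => simpa using hp i
  refine (minKept_le hmem).trans ?_
  rw [← hmin]
  refine Submodule.finrank_mono (tupleQuadrics_anti ?_)
  rintro _ ⟨i, rfl⟩
  exact ⟨i.castSucc, by simp⟩

theorem minKept_succ_lt {X : Set (Pt m)} (hX : X.Nonempty) (hnd : IsNondegenerate X) {j : ℕ}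
    (hj : minKept X j ≠ 0) : minKept X (j + 1) < minKept X j := by
  obtain ⟨p, hp, hmin⟩ := exists_minKept_eq hX j
  have hne : tupleQuadrics X p ≠ ⊥ := fun h => hj (by rw [← hmin, h, finrank_bot])
  obtain ⟨q, hq, hq0⟩ := Submodule.exists_mem_ne_zero_of_ne_bot hne
  obtain ⟨x, hx, y, -, hxy⟩ := exists_polarForm_ne_zero hnd hq.1 hq0
  have hmem : Fin.snoc p x ∈ power X (j + 1) := fun i => by
    induction i using Fin.lastCases with
    | last => simpa using hx
    | cast i => simpa using hp i
  refine (minKept_le hmem).trans_lt ?_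
  rw [← hmin]
  refine Submodule.finrank_lt_finrank_of_lt (lt_of_le_of_ne (tupleQuadrics_anti ?_) fun h => ?_)
  · rintro _ ⟨i, rfl⟩
    exact ⟨i.castSucc, by simp⟩
  · rw [← h, mem_tupleQuadrics] at hq
    have := hq.2 (Fin.last j)
    rw [Fin.snoc_last] at this
    exact hxy (by rw [this, LinearMap.zero_apply])

theorem isSliceHomogeneous_polarForm {ι : Type} [DecidableEq ι] (q : MvPolynomial (Fin m) ℂ)
    {a b : ι} (hab : a ≠ b) :
    IsSliceHomogeneous fun p : ι → Pt m => polarForm m q (p a).rep (p b).rep := by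
  have lin : ∀ ℓ : (Fin m → ℂ) →ₗ[ℂ] ℂ, ∃ (d : ℕ) (f : MvPolynomial (Fin m) ℂ),
      f.IsHomogeneous d ∧ ∀ x : Pt m, ℓ x.rep = MvPolynomial.eval x.rep f := by
    intro ℓ
    refine ⟨1, ∑ i, MvPolynomial.C (ℓ (Pi.single i 1)) * MvPolynomial.X i,
      MvPolynomial.IsHomogeneous.sum _ _ _ fun i _ => MvPolynomial.isHomogeneous_C_mul_X _ _,
      fun x => ?_⟩
    conv_lhs => rw [← Finset.univ_sum_single x.rep, map_sum]
    rw [map_sum]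
    refine Finset.sum_congr rfl fun i _ => ?_
    rw [map_mul, MvPolynomial.eval_C, MvPolynomial.eval_X, mul_comm, ← smul_eq_mul, ← map_smul,
      ← Pi.single_smul, smul_eq_mul, mul_one]
  intro i p
  by_cases ha : i = a
  · subst ha
    obtain ⟨d, f, hf, h⟩ := lin (polarForm m q (p b).rep)
    refine ⟨d, f, hf, fun x => ?_⟩
    simp [hab.symm, ← h, polarForm_comm q x.rep]
  by_cases hb : i = b
  · subst hb
    obtain ⟨d, f, hf, h⟩ := lin (polarForm m q (p a).rep)
    refine ⟨d, f, hf, fun x => ?_⟩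
    simp [hab, ← h]
  · exact ⟨0, MvPolynomial.C (polarForm m q (p a).rep (p b).rep), MvPolynomial.isHomogeneous_C _ _,
      fun x => by simp [Ne.symm ha, Ne.symm hb]⟩

theorem minKept_strictly_convex {X : Set (Pt m)} (hX : IsIrreducibleVariety X)
    (hnd : IsNondegenerate X) {j : ℕ} (hj : minKept X j ≠ 0) :
    2 * minKept X (j + 1) < minKept X j + minKept X (j + 2) := by
  obtain ⟨u, hu, humin⟩ := exists_minKept_eq hX.1 j
  obtain ⟨v, hv, hvmin⟩ := exists_minKept_eq hX.1 (j + 2)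
  obtain ⟨f, hf, hfu, hfle⟩ := exists_multihomogeneous X u
  obtain ⟨g, hg, hgv, hgle⟩ := exists_multihomogeneous X v
  let e : Fin j → Fin (j + 2) := fun i => i.castSucc.castSucc
  have he : Function.Injective e := (Fin.castSucc_injective _).comp (Fin.castSucc_injective _)
  let a : Fin (j + 2) := (Fin.last j).castSucc
  let b : Fin (j + 2) := Fin.last (j + 1)
  have hab : a ≠ b := (Fin.castSucc_lt_last _).ne
  obtain ⟨x₀, hx₀⟩ := hX.1
  have hcases : ∀ {P : Fin (j + 2) → Prop}, (∀ i, P (e i)) → P a → P b → ∀ i, P i :=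
    fun {P} he ha hb => Fin.lastCases hb (Fin.lastCases ha he)
  let extend : (Fin j → Pt m) → Pt m → Pt m → Fin (j + 2) → Pt m := fun p x y =>
    Fin.snoc (Fin.snoc p x : Fin (j + 1) → Pt m) y
  have hext_e : ∀ p x y i, extend p x y (e i) = p i := by intro p x y i; simp [extend, e]
  have hext_a : ∀ p x y, extend p x y a = x := by intro p x y; simp [extend, a]
  have hext_b : ∀ p x y, extend p x y b = y := by intro p x y; simp [extend, b]
  have hextX : ∀ p x y, (∀ i, p i ∈ X) → x ∈ X → y ∈ X → ∀ i, extend p x y i ∈ X := by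
    intro p x y hp hx hy
    refine hcases (fun i => ?_) ?_ ?_
    · rw [hext_e]; exact hp i
    · rwa [hext_a]
    · rwa [hext_b]
  -- One tuple r whose first j points attain κ_j and which as a whole attains κ_{j+2}; the filler x₀
  -- is arbitrary.
  obtain ⟨r, hr, hfr, hgr, -⟩ := exists_common_ne_zero hX (hf.isSliceHomogeneous.comp he)
    hg.isSliceHomogeneous (hextX u x₀ x₀ hu hx₀ hx₀) hv
    (by convert hfu using 2; exact funext fun i => hext_e u x₀ x₀ i) hgv
  have hjr : Module.finrank ℂ (tupleQuadrics X (r ∘ e)) = minKept X j :=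
    le_antisymm ((hfle _ hfr).trans_eq humin) (minKept_le fun i => hr _)
  have hne : tupleQuadrics X (r ∘ e) ≠ ⊥ := fun h => hj (by rw [← hjr, h, finrank_bot])
  obtain ⟨q, hq, hq0⟩ := Submodule.exists_mem_ne_zero_of_ne_bot hne
  obtain ⟨x, hx, y, hy, hxy⟩ := exists_polarForm_ne_zero hnd hq.1 hq0
  -- Only the last two points of r move, so q stays singular at the first j. Now B_q(a, b) ≠ 0, and
  -- κ_{j+2} is still attained.
  obtain ⟨s, hs, hgs, hqs, hrs⟩ := exists_common_ne_zero hX hg.isSliceHomogeneous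
    (isSliceHomogeneous_polarForm q hab) hr (hextX (r ∘ e) x y (fun i => hr _) hx hy) hgr
    (by rwa [hext_a, hext_b])
  have hse : s ∘ e = r ∘ e := funext fun i => hrs _ (hext_e (r ∘ e) x y i).symm
  have hmin : Module.finrank ℂ (tupleQuadrics X s) = minKept X (j + 2) :=
    le_antisymm ((hgle _ hgs).trans_eq hvmin) (minKept_le hs)
  let sa : Fin (j + 1) → Pt m := Fin.snoc (s ∘ e) (s a)
  let sb : Fin (j + 1) → Pt m := Fin.snoc (s ∘ e) (s b)
  have hmem : ∀ (c : Fin (j + 2)) (f : MvPolynomial (Fin m) ℂ),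
      f ∈ tupleQuadrics X (Fin.snoc (s ∘ e) (s c) : Fin (j + 1) → Pt m) ↔
        f ∈ tupleQuadrics X (s ∘ e) ∧ polarForm m f (s c).rep = 0 := by
    intro c f
    rw [mem_tupleQuadrics, mem_tupleQuadrics, Fin.forall_fin_succ', and_assoc]
    simp
  have hinf : tupleQuadrics X sa ⊓ tupleQuadrics X sb = tupleQuadrics X s := by
    ext f
    rw [Submodule.mem_inf, hmem, hmem, mem_tupleQuadrics, mem_tupleQuadrics]
    constructor
    · rintro ⟨⟨⟨hfX, h1⟩, h2⟩, -, h3⟩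
      exact ⟨hfX, hcases h1 h2 h3⟩
    · rintro ⟨hfX, h⟩
      exact ⟨⟨⟨hfX, fun i => h _⟩, h _⟩, ⟨hfX, fun i => h _⟩, h _⟩
  have hsup : tupleQuadrics X sa ⊔ tupleQuadrics X sb < tupleQuadrics X (r ∘ e) := by
    rw [← hse]
    refine lt_of_le_of_ne (sup_le (fun f hf => ((hmem a f).1 hf).1)
      (fun f hf => ((hmem b f).1 hf).1)) fun h => hqs ?_
    -- If the sum were everything, q would split into a form with a in its radical and one with b in
    -- its radical, forcing B_q(a, b) = 0.
    rw [← hse, ← h, Submodule.mem_sup] at hq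
    obtain ⟨q₁, h₁, q₂, h₂, rfl⟩ := hq
    rw [map_add, LinearMap.add_apply, LinearMap.add_apply, ((hmem a q₁).1 h₁).2,
      polarForm_comm q₂, ((hmem b q₂).1 h₂).2]
    simp
  have hlt := Submodule.finrank_lt_finrank_of_lt hsup
  have hadd := Submodule.finrank_sup_add_finrank_inf_eq (tupleQuadrics X sa) (tupleQuadrics X sb)
  rw [hinf, hmin] at hadd
  have hX1 : ∀ c, (Fin.snoc (s ∘ e) (s c) : Fin (j + 1) → Pt m) ∈ power X (j + 1) := fun c i => by
    induction i using Fin.lastCases with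
    | last => simpa using hs c
    | cast i => simpa using hs (e i)
  have ha := minKept_le (hX1 a)
  have hb := minKept_le (hX1 b)
  change _ ≤ Module.finrank ℂ (tupleQuadrics X sa) at ha
  change _ ≤ Module.finrank ℂ (tupleQuadrics X sb) at hb
  omega

/-! ### Quadratic persistence -/

theorem minKept_zero {X : Set (Pt m)} (hX : X.Nonempty) :
    minKept X 0 = Module.finrank ℂ (quadrics X) := by
  obtain ⟨p, -, hp⟩ := exists_minKept_eq hX 0
  have : tupleQuadrics X p = quadrics X :=
    le_antisymm (tupleQuadrics_le_quadrics X p) fun q hq =>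
      mem_tupleQuadrics.2 ⟨hq, fun i => i.elim0⟩
  rw [← hp, this]

theorem exists_minKept_eq_zero {X : Set (Pt m)} (hX : X.Nonempty) (hnd : IsNondegenerate X) :
    ∃ j, minKept X j = 0 := by
  by_contra! h
  have hle : ∀ j, minKept X j + j ≤ minKept X 0 := by
    intro j
    induction j with
    | zero => rfl
    | succ j ih =>
      have := minKept_succ_lt hX hnd (h j)
      omega
  have := hle (minKept X 0 + 1)
  omega

/-- The points of a minimizing tuple may coincide, so the cardinality is only bounded by j. -/
theorem exists_finset_of_minKept_eq_zero {X : Set (Pt m)} (hX : X.Nonempty) {j : ℕ}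
    (hj : minKept X j = 0) : ∃ Γ : Finset (Pt m), (Γ : Set (Pt m)) ⊆ X ∧ Γ.card ≤ j ∧
      quadrics (projImage (Γ : Set (Pt m)) X) = ⊥ := by
  classical
  obtain ⟨p, hp, hmin⟩ := exists_minKept_eq hX j
  refine ⟨Finset.univ.image p, ?_, Finset.card_image_le.trans_eq (Finset.card_fin j), ?_⟩
  · intro x hx
    obtain ⟨i, -, rfl⟩ := Finset.mem_image.1 (Finset.mem_coe.1 hx)
    exact hp i
  · rw [quadrics_projImage_eq_bot_iff, Finset.coe_image, Finset.coe_univ, Set.image_univ,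
      ← Set.range_comp]
    change tupleQuadrics X p = ⊥
    exact Submodule.finrank_eq_zero.1 (hmin.trans hj)

theorem minKept_eq_zero_iff {X : Set (Pt m)} (hX : X.Nonempty) (hnd : IsNondegenerate X) (j : ℕ) :
    minKept X j = 0 ↔ qp X ≤ j := by
  constructor
  · intro hj
    obtain ⟨Γ, hΓX, hΓj, hΓ⟩ := exists_finset_of_minKept_eq_zero hX hj
    exact (Nat.sInf_le ⟨Γ, hΓX, rfl, hΓ⟩ : qp X ≤ Γ.card).trans hΓj
  · intro hj
    obtain ⟨i, hi⟩ := exists_minKept_eq_zero hX hnd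
    obtain ⟨Γ₀, hΓ₀X, -, hΓ₀⟩ := exists_finset_of_minKept_eq_zero hX hi
    obtain ⟨Γ, hΓX, hcard, hΓ⟩ : qp X ∈ _ := Nat.sInf_mem ⟨_, Γ₀, hΓ₀X, rfl, hΓ₀⟩
    let e := Γ.equivFinOfCardEq hcard
    let p : Fin (qp X) → Pt m := fun i => e.symm i
    have hrange : Set.range p = (Γ : Set (Pt m)) := by
      have : p = Subtype.val ∘ e.symm := rfl
      rw [this, Set.range_comp, e.symm.range_eq_univ, Set.image_univ, Subtype.range_coe]
    rw [quadrics_projImage_eq_bot_iff, ← hrange, ← Set.range_comp] at hΓ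
    have hp : p ∈ power X (qp X) := fun i => hΓX (e.symm i).2
    have h0 : Module.finrank ℂ (tupleQuadrics X p) = 0 := Submodule.finrank_eq_zero.2 hΓ
    have h1 := minKept_le hp
    have h2 := antitone_minKept hX hj
    omega

/-- The drop is the rank of the gradients of the quadrics at a single point of X, which the Jacobian
criterion bounds. -/
theorem minKept_zero_le {n : ℕ} {X : Set (Pt (n + 1))} (hXc : IsSubvariety X)
    (hX : IsIrreducibleVariety X) :
    minKept X 0 ≤ minKept X 1 + codimension X := by
  obtain ⟨p, hp, hmin⟩ := exists_minKept_eq hX.1 1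
  obtain ⟨q, hq⟩ := exists_linearIndependent_gradients X p
  have hli : LinearIndependent ℂ fun u =>
      polarForm (n + 1) (q u : MvPolynomial (Fin (n + 1)) ℂ) (p 0).rep := by
    let T : ((Fin (n + 1) → ℂ) →ₗ[ℂ] ℂ) →ₗ[ℂ] (Fin 1 × Fin (n + 1) → ℂ) :=
      LinearMap.pi fun x => LinearMap.applyₗ (Pi.single x.2 1)
    refine LinearIndependent.of_comp T ?_
    convert hq using 1
    ext u x
    rw [gradients_apply, Subsingleton.elim x.1 0]
    rfl
  have h1 := add_dimension_le hXc hX (hp 0) _ (fun u => (q u).2) hli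
  have h2 := finrank_range_gradients_add X p
  rw [minKept_zero hX.1, codimension]
  omega

/-! ### Strictly convex sequences -/

/-- Counted backwards from k, the s-th drop is at least s, so κ 0 is at least 1 + ... + k. -/
theorem choose_le_of_strictly_convex {κ : ℕ → ℕ} {k : ℕ}
    (hdec : ∀ j < k, κ (j + 1) < κ j)
    (hconv : ∀ j < k, 2 * κ (j + 1) < κ j + κ (j + 2)) : (k + 1).choose 2 ≤ κ 0 := by
  -- The case s = 0 is split off because nothing is assumed about the drop from k to k + 1.
  have h : ∀ s ≤ k, (s + 1).choose 2 ≤ κ (k - s) ∧ κ (k - s + 1) + s ≤ κ (k - s) ∨ s = 0 := by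
    intro s
    induction s with
    | zero => exact fun _ => Or.inr rfl
    | succ s ih =>
      intro hs
      left
      have hchoose : (s + 1 + 1).choose 2 = (s + 1) + (s + 1).choose 2 := by
        rw [Nat.choose_succ_succ', Nat.choose_one_right]
      obtain ⟨i, hi⟩ : ∃ i, k - s = i + 1 := ⟨k - s - 1, by omega⟩
      have hi' : k - (s + 1) = i := by omega
      rw [hi', hchoose]
      have hd := hdec i (by omega)
      have hc : 2 * κ (i + 1) < κ i + κ (i + 1 + 1) := hconv i (by omega)
      rcases ih (by omega) with ⟨h1, h2⟩ | rfl
      · rw [hi] at h1 h2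
        omega
      · simp only [zero_add, Nat.choose_succ_self, add_zero]
        omega
  rcases h k le_rfl with ⟨h1, -⟩ | rfl
  · simpa using h1
  · simp

/-- The drop at j is at most c - j, and the sum of these over j < k is kc minus the binomial
coefficient. -/
theorem le_of_strictly_convex {κ : ℕ → ℕ} {k c : ℕ} (hk : κ k = 0) (hc : κ 0 ≤ κ 1 + c)
    (hconv : ∀ j < k, 2 * κ (j + 1) < κ j + κ (j + 2)) :
    (κ 0 : ℤ) ≤ k * c - k.choose 2 := by
  have hslope : ∀ j ≤ k, κ j + j ≤ κ (j + 1) + c := by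
    intro j
    induction j with
    | zero => intro _; omega
    | succ j ih =>
      intro hj
      have := ih (by omega)
      have := hconv j (by omega)
      change κ (j + 1) + (j + 1) ≤ κ (j + 2) + c
      omega
  have hsum : ∀ s ≤ k, (κ 0 : ℤ) ≤ κ s + s * c - s.choose 2 := by
    intro s
    induction s with
    | zero => simp
    | succ s ih =>
      intro hs
      have h1 := ih (by omega)
      have h2 := hslope s (by omega)
      have hchoose : (s + 1).choose 2 = s + s.choose 2 := by
        rw [Nat.choose_succ_succ', Nat.choose_one_right]
      rw [hchoose]
      zify at h2
      push_cast
      linarith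
  simpa [hk] using hsum k le_rfl

end QuadPersist

end

theorem corollary3 (n : ℕ) (X : Set (QuadPersist.Pt (n + 1)))
    (hX : QuadPersist.IsSubvariety X)
    (hirr : QuadPersist.IsIrreducibleVariety X)
    (hnd : QuadPersist.IsNondegenerate X) :
    (∀ j k : ℕ, QuadPersist.IsGeneralKept X j k ↔ k = QuadPersist.generalKept X j) ∧
    Antitone (QuadPersist.generalKept X) ∧
    (∀ j : ℕ, QuadPersist.generalKept X j ≠ 0 ↔ j < QuadPersist.qp X) ∧
    (∀ j : ℕ, j < QuadPersist.qp X →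
      QuadPersist.generalKept X (j + 1) < QuadPersist.generalKept X j) ∧
    (∀ j : ℕ, 0 < j → j ≤ QuadPersist.qp X →
      2 * QuadPersist.generalKept X j <
        QuadPersist.generalKept X (j - 1) + QuadPersist.generalKept X (j + 1)) ∧
    (QuadPersist.qp X + 1).choose 2 ≤ Module.finrank ℂ (QuadPersist.quadrics X) ∧
    (Module.finrank ℂ (QuadPersist.quadrics X) : ℤ) ≤
      (QuadPersist.qp X : ℤ) * (QuadPersist.codimension X : ℤ) -
        ((QuadPersist.qp X).choose 2 : ℤ) := by
  have hgen : QuadPersist.generalKept X = QuadPersist.minKept X :=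
    funext (QuadPersist.generalKept_eq_minKept hirr)
  have hzero := QuadPersist.minKept_eq_zero_iff hirr.1 hnd
  have hne : ∀ j, QuadPersist.minKept X j ≠ 0 ↔ j < QuadPersist.qp X := fun j => by
    rw [Ne, hzero, not_le]
  have hdec : ∀ j < QuadPersist.qp X,
      QuadPersist.minKept X (j + 1) < QuadPersist.minKept X j := fun j hj =>
    QuadPersist.minKept_succ_lt hirr.1 hnd ((hne j).2 hj)
  -- Convexity centred at j + 1 only needs κ_j ≠ 0, so the middle index may equal qp(X), where the
  -- sequence is already zero.
  have hconv : ∀ j < QuadPersist.qp X, 2 * QuadPersist.minKept X (j + 1) <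
      QuadPersist.minKept X j + QuadPersist.minKept X (j + 2) := fun j hj =>
    QuadPersist.minKept_strictly_convex hirr hnd ((hne j).2 hj)
  rw [hgen]
  refine ⟨QuadPersist.isGeneralKept_iff hirr, QuadPersist.antitone_minKept hirr.1, hne, hdec,
    fun j hj hjq => ?_, ?_, ?_⟩
  · obtain ⟨i, rfl⟩ := Nat.exists_eq_succ_of_ne_zero hj.ne'
    exact hconv i hjq
  · rw [← QuadPersist.minKept_zero hirr.1]
    exact QuadPersist.choose_le_of_strictly_convex hdec hconv
  · rw [← QuadPersist.minKept_zero hirr.1]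
    exact QuadPersist.le_of_strictly_convex ((hzero _).2 le_rfl)
      (QuadPersist.minKept_zero_le hX hirr) hconv
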